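/- Let $K$ be a commutative $\mathbb Q$-algebra with a derivation $\partial$, and let $\alpha\in K$ be a constant, $\partial\alpha=0$. Let $C=K[A_n^{(k)},\varphi^{(k)}:n,k\ge 0][A_0^{-1}]$ be the ring of differential functions of $A_0,A_1,A_2,\dots$ and $\varphi$, where $\partial$ is extended by $\partial(A_n^{(k)})=A_n^{(k+1)}$, $\partial(\varphi^{(k)})=\varphi^{(k+1)}$; similarly let $C'=K[u^{(k)},h^{(k)},\varphi^{(k)}:k\ge0][h^{-1}]$. Write $f_x=\partial f$ and let $\dagger$ be the formal adjoint of a differential operator. Consider the matrix $\bar{\mathcal B}$ of differential operators over $C$, with rows and columns indexed by $n,m\in\mathbb Z_{\ge0}$ and $\varphi$: $$\bar{\mathcal B}_{nm}=\sum_{\mu\ge0}\Big[\tbinom n\mu A_{n+m-\mu}\partial^\mu-(-\partial)^\mu\tbinom m\mu A_{n+m-\mu}\Big],$$ $$\bar{\mathcal B}_{\varphi m}=(\varphi_x+\alpha\varphi\partial)\frac1{A_0}\sum_{s\ge0}(-\partial)^s\tbinom m{s+1}A_{m-1-s},$$ $$\bar{\mathcal B}_{n\varphi}=\sum_{s\ge0}\tbinom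 n{s+1}A_{n-1-s}\partial^s\frac1{A_0}(\alpha\partial\varphi-\varphi_x),\qquad \bar{\mathcal B}_{\varphi\varphi}=0 .$$ Then: 1. $\bar{\mathcal B}$ is Hamiltonian. That is: $\bar{\mathcal B}^\dagger=-\bar{\mathcal B}$; the bracket $\{H,F\}=\sum_{i,j}\frac{\delta F}{\delta q_i}\bar{\mathcal B}_{ij}\big(\frac{\delta H}{\delta q_j}\big)$, $H,F\in C$ (where $q_i$ runs over all the variables $A_n,\varphi$), satisfies the Jacobi identity modulo $\partial C$; and $X_{\{H,F\}}=[X_H,X_F]$ for all $H,F\in C$, where $X_H$ is the evolution derivation, the $K$-linear derivation of $C$ with $X_H(q_i)=\sum_j\bar{\mathcal B}_{ij}\big(\frac{\delta H}{\delta q_j}\big)$ and $X_H(q_i^{(k)})=\partial^k X_H(q_i)$. 2. The quasiclassical limit of $\bar{\mathcal B}$ is the matrix $$\mathcal B_{nm}=nA_{n+m-1}\partial+\partial\, mA_{n+m-1},\quad \mathcal B_{\varphi m}=(\varphi_x+\alpha\varphi\partial)\frac{mA_{m-1}}{A_0},\quad \mathcal B_{n\varphi}=\frac{nA_{n-1}}{A_0}(\alpha\partial\varphi-\varphi_x),\quad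 \mathcal B_{\varphi\varphi}=0,$$ that is, replacing $\partial$ by $\varepsilon\partial$ everywhere in $\bar{\mathcal B}$ (so also $q_i^{(k)}$ by $\varepsilon^kq_i^{(k)}$ in the coefficients) gives $\varepsilon\mathcal B+O(\varepsilon^2)$ in every entry. 3. Under the differential substitution $\Phi:C\to C'$, $A_i=hQ_i(u)$, $Q_i(u)=(\partial+u)^i(1)$, $\varphi=\varphi$, the matrix $\bar{\mathcal B}$ reduces to the matrix $$B=\begin{pmatrix}0&\partial&-\frac1h\varphi_x+\alpha\frac1h\partial\varphi\\ \partial&0&0\\ \frac1h\varphi_x+\alpha\varphi\partial\frac1h&0&0\end{pmatrix}$$ in the variables $(u,h,\varphi)$, that is, $\Phi(\bar{\mathcal B})=J\,B\,J^\dagger$, where $\Phi$ is applied to the coefficients of the entries and $J$ is the Jacobian, formed by the Fréchet derivatives of $(hQ_0,hQ_1,\dots;\varphi)$ with respect to $(u,h,\varphi)$. -/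

import Mathlib

open scoped Differential

noncomputable section

namespace KPExt

/-! ### Scalar differential operators over a commutative differential ring -/

section DiffOp

variable {R : Type*} [CommRing R] [Differential R]

/-- The `k`-th derivative `f^{(k)}`. -/
def iter (k : ℕ) (f : R) : R := (fun g : R => g′)^[k] f

/-- Formal differential operators `∑ aₖ ∂ᵏ` with coefficients (written on the left) in `R`.
The polynomial variable `X` stands for `∂`, and the constant polynomial `C a` for the operator of
multiplication by `a`. Only the additive structure, and the coefficients, of `Polynomial R` are
meaningful in general; the product of operators is `DiffOp.comp`. -/
abbrev DiffOp (R : Type*) [CommRing R] : Type _ := Polynomial R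

/-- The operator of multiplication by `a`. -/
abbrev mulOp (a : R) : DiffOp R := Polynomial.C a

/-- The operator `a ∂ᵏ`. -/
abbrev mon (k : ℕ) (a : R) : DiffOp R := Polynomial.monomial k a

/-- The operator `(-∂)ᵏ`. -/
abbrev negDPow (R : Type*) [CommRing R] (k : ℕ) : DiffOp R := mon k ((-1) ^ k)

/-- The action of an operator on a function: `(∑ aₖ ∂ᵏ)(f) = ∑ aₖ f^{(k)}`. -/
def DiffOp.act (P : DiffOp R) (f : R) : R := P.sum fun k a => a * iter k f

/-- The composition of operators, bilinear and given by the Leibniz rule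
`(a ∂ⁱ) ∘ (b ∂ʲ) = ∑ₗ (i choose l) a b^{(l)} ∂^{i - l + j}`. -/
def DiffOp.comp (P Q : DiffOp R) : DiffOp R :=
  P.sum fun i a => Q.sum fun j b =>
    ∑ l ∈ Finset.range (i + 1), mon (i - l + j) ((i.choose l : R) * (a * iter l b))

/-- The formal adjoint `(∑ aₖ ∂ᵏ)† = ∑ (-∂)ᵏ ∘ aₖ`. -/
def DiffOp.adj (P : DiffOp R) : DiffOp R :=
  P.sum fun k a => DiffOp.comp (negDPow R k) (mulOp a)

end DiffOp

infixr:75 " ⊙ " => DiffOp.comp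

/-! ### Differential functions of the variables `qᵢ` -/

section Jet

variable {K : Type*} [CommRing K] {ι : Type*} {z : ι}

/-- The ring of differential functions `K[qᵢ^{(k)} : i ∈ ι, k ≥ 0][q_z⁻¹]`: differential
polynomials over `K` in the variables `qᵢ`, with `q_z` inverted. -/
def Jet (K : Type*) [CommRing K] (ι : Type*) (z : ι) : Type _ :=
  Localization.Away (MvPolynomial.X (z, 0) : MvPolynomial (ι × ℕ) K)

instance : CommRing (Jet K ι z) :=
  inferInstanceAs (CommRing
    (Localization.Away (MvPolynomial.X (z, 0) : MvPolynomial (ι × ℕ) K)))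

instance : Algebra (MvPolynomial (ι × ℕ) K) (Jet K ι z) :=
  inferInstanceAs (Algebra (MvPolynomial (ι × ℕ) K)
    (Localization.Away (MvPolynomial.X (z, 0) : MvPolynomial (ι × ℕ) K)))

instance : IsLocalization.Away (MvPolynomial.X (z, 0) : MvPolynomial (ι × ℕ) K) (Jet K ι z) :=
  inferInstanceAs (IsLocalization.Away (MvPolynomial.X (z, 0) : MvPolynomial (ι × ℕ) K)
    (Localization.Away (MvPolynomial.X (z, 0) : MvPolynomial (ι × ℕ) K)))

/-- The coordinate `qᵢ^{(k)}`; in particular `q i 0` is the variable `qᵢ` itself. -/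
def q (i : ι) (k : ℕ) : Jet K ι z :=
  algebraMap (MvPolynomial (ι × ℕ) K) (Jet K ι z) (MvPolynomial.X (i, k))

/-- Elements of the ground ring as differential functions. -/
def base : K →+* Jet K ι z :=
  (algebraMap (MvPolynomial (ι × ℕ) K) (Jet K ι z)).comp MvPolynomial.C

/-- The element `q_z⁻¹`. -/
def qInv : Jet K ι z :=
  IsLocalization.Away.invSelf (MvPolynomial.X (z, 0) : MvPolynomial (ι × ℕ) K)

theorem q_mul_qInv : (q z 0 : Jet K ι z) * qInv = 1 :=
  IsLocalization.Away.mul_invSelf _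

/-- The ring homomorphism out of `Jet K ι z` with prescribed values on the ground ring and on the
coordinates. -/
def Jet.lift {S : Type*} [CommRing S] (f : K →+* S) (v : ι → ℕ → S) (hv : IsUnit (v z 0)) :
    Jet K ι z →+* S :=
  IsLocalization.Away.lift (S := Jet K ι z)
    (MvPolynomial.X (z, 0) : MvPolynomial (ι × ℕ) K)
    (g := MvPolynomial.eval₂Hom f fun p : ι × ℕ => v p.1 p.2) (by simpa using hv)

@[simp] theorem Jet.lift_base {S : Type*} [CommRing S] (f : K →+* S) (v : ι → ℕ → S)
    (hv : IsUnit (v z 0)) (a : K) : Jet.lift (z := z) f v hv (base a) = f a := by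
  simp [Jet.lift, base]

@[simp] theorem Jet.lift_q {S : Type*} [CommRing S] (f : K →+* S) (v : ι → ℕ → S)
    (hv : IsUnit (v z 0)) (i : ι) (k : ℕ) : Jet.lift (z := z) f v hv (q i k) = v i k := by
  simp [Jet.lift, q]

theorem Jet.hom_ext {S : Type*} [CommRing S] {f g : Jet K ι z →+* S}
    (hb : ∀ a, f (base a) = g (base a)) (hq : ∀ i k, f (q i k) = g (q i k)) : f = g := by
  refine IsLocalization.ringHom_ext
    (Submonoid.powers (MvPolynomial.X (z, 0) : MvPolynomial (ι × ℕ) K)) ?_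
  refine MvPolynomial.ringHom_ext ?_ ?_
  · intro a; exact hb a
  · rintro ⟨i, k⟩; exact hq i k

/-- For a derivation `d` of the ground ring and elements `v i k`, the ring homomorphism
`F ↦ F + ε D(F)` to the dual numbers, where `D` is the derivation with `D = d` on `K` and
`D(qᵢ^{(k)}) = v i k`. -/
def dualLift (d : Derivation ℤ K K) (v : ι → ℕ → Jet K ι z) :
    Jet K ι z →+* DualNumber (Jet K ι z) :=
  Jet.lift
    { toFun := fun a => TrivSqZeroExt.inl (base a) + TrivSqZeroExt.inr (base (d a))
      map_one' := by ext <;> simp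
      map_zero' := by ext <;> simp
      map_add' := fun a b => by ext <;> simp
      map_mul' := fun a b => by ext <;> simp [mul_comm] }
    (fun i k => TrivSqZeroExt.inl (q i k) + TrivSqZeroExt.inr (v i k))
    (by
      rw [TrivSqZeroExt.isUnit_iff_isUnit_fst]
      simpa using IsUnit.of_mul_eq_one _ (q_mul_qInv (K := K) (z := z)))

theorem fst_dualLift (d : Derivation ℤ K K) (v : ι → ℕ → Jet K ι z) (F : Jet K ι z) :
    (dualLift d v F).fst = F := by
  have h : ((TrivSqZeroExt.fstHom (Jet K ι z) (Jet K ι z) (Jet K ι z)).toRingHom).comp (dualLift d v) =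
      RingHom.id _ := by
    apply Jet.hom_ext
    · intro a; simp [dualLift]
    · intro i k; simp [dualLift]
  exact congrArg (fun g : Jet K ι z →+* Jet K ι z => g F) h

/-- The unique derivation `D` of the ring of differential functions that restricts to `d` on the
ground ring and has `D(qᵢ^{(k)}) = v i k`. -/
def mkDer (d : Derivation ℤ K K) (v : ι → ℕ → Jet K ι z) :
    Derivation ℤ (Jet K ι z) (Jet K ι z) :=
  Derivation.mk'
    { toFun := fun F => (dualLift d v F).snd
      map_add' := fun F G => by simp
      map_smul' := fun n F => by simp }
    (fun F G => by simp [fst_dualLift, mul_comm])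

@[simp] theorem mkDer_base (d : Derivation ℤ K K) (v : ι → ℕ → Jet K ι z) (a : K) :
    mkDer d v (base a) = base (d a) := by
  simp [mkDer, dualLift]

@[simp] theorem mkDer_q (d : Derivation ℤ K K) (v : ι → ℕ → Jet K ι z) (i : ι) (k : ℕ) :
    mkDer d v (q i k) = v i k := by
  simp [mkDer, dualLift]

/-- The partial derivative `∂/∂qᵢ^{(k)}`. -/
def pd (i : ι) (k : ℕ) : Derivation ℤ (Jet K ι z) (Jet K ι z) :=
  open scoped Classical in mkDer 0 fun j l => if j = i ∧ l = k then 1 else 0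

theorem finite_pd (F : Jet K ι z) : {p : ι × ℕ | pd p.1 p.2 F ≠ 0}.Finite := by
  classical
  have hP : ∀ P : MvPolynomial (ι × ℕ) K,
      {p : ι × ℕ | pd p.1 p.2 (algebraMap _ (Jet K ι z) P) ≠ 0}.Finite := by
    intro P
    induction P using MvPolynomial.induction_on with
    | C a =>
      convert Set.finite_empty
      ext p
      have := mkDer_base (z := z) (0 : Derivation ℤ K K)
        (fun j l => if j = p.1 ∧ l = p.2 then 1 else 0) a
      simpa [base, pd] using this
    | add P Q hP hQ =>
      refine (hP.union hQ).subset ?_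
      intro p hp
      by_contra h
      simp only [Set.mem_union, Set.mem_ofPred_eq, not_or, not_not] at h
      exact hp (by simp [h.1, h.2])
    | mul_X P r hP =>
      refine (hP.union (Set.finite_singleton r)).subset ?_
      intro p hp
      by_contra h
      simp only [Set.mem_union, Set.mem_ofPred_eq, not_or, not_not, Set.mem_singleton_iff] at h
      have hr : pd p.1 p.2 (algebraMap (MvPolynomial (ι × ℕ) K) (Jet K ι z) (MvPolynomial.X r)) = 0 := by
        have := mkDer_q (z := z) (0 : Derivation ℤ K K)
          (fun j l => if j = p.1 ∧ l = p.2 then 1 else 0) r.1 r.2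
        rw [if_neg (fun hh => h.2 (Prod.ext hh.1.symm hh.2.symm))] at this
        exact this
      exact hp (by rw [map_mul, Derivation.leibniz, hr, h.1]; simp)
  obtain ⟨⟨P, s⟩, hs⟩ := IsLocalization.surj
    (Submonoid.powers (MvPolynomial.X (z, 0) : MvPolynomial (ι × ℕ) K)) F
  simp only at hs
  refine ((hP P).union (hP s)).subset ?_
  intro p hp
  by_contra h
  simp only [Set.mem_union, Set.mem_ofPred_eq, not_or, not_not] at h
  have h1 := congrArg (pd p.1 p.2) hs
  rw [Derivation.leibniz, h.1, h.2, smul_zero, zero_add, smul_eq_mul] at h1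
  exact hp ((IsLocalization.map_units (Jet K ι z) s).mul_right_eq_zero.mp h1)

/-- All partial derivatives of a differential function: `grad F (i, k) = ∂F/∂qᵢ^{(k)}`. -/
def grad (F : Jet K ι z) : ι × ℕ →₀ Jet K ι z :=
  Finsupp.ofSupportFinite (fun p => pd p.1 p.2 F) (finite_pd F)

/-- The Fréchet derivative `DF/Dqᵢ = ∑ₖ (∂F/∂qᵢ^{(k)}) ∂ᵏ`. -/
def frechet (F : Jet K ι z) (i : ι) : DiffOp (Jet K ι z) :=
  open scoped Classical in (grad F).sum fun p a => if p.1 = i then mon p.2 a else 0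

variable [Differential K]

/-- The total derivative `∂ = d/dx`: it extends the derivation of the ground ring and maps
`qᵢ^{(k)}` to `qᵢ^{(k+1)}`. -/
instance : Differential (Jet K ι z) where
  deriv := mkDer Differential.deriv fun i k => q i (k + 1)

/-- The vector of variational derivatives `δF/δqᵢ = ∑ₖ (-∂)ᵏ (∂F/∂qᵢ^{(k)})`; it has finitely many
nonzero components. -/
def varDer (F : Jet K ι z) : ι →₀ Jet K ι z :=
  (grad F).sum fun p a => Finsupp.single p.1 ((-1) ^ p.2 * iter p.2 a)

/-- The evolution field `qᵢ,ₜ = Vᵢ`: the derivation vanishing on the ground ring with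
`qᵢ^{(k)} ↦ ∂ᵏ(Vᵢ)`. -/
def evol (V : ι → Jet K ι z) : Derivation ℤ (Jet K ι z) (Jet K ι z) :=
  mkDer 0 fun i k => iter k (V i)

/-! ### Hamiltonian matrices -/

/-- Square matrices, possibly infinite, of differential operators. -/
abbrev OpMatrix (K : Type*) [CommRing K] (ι : Type*) (z : ι) : Type _ :=
  ι → ι → DiffOp (Jet K ι z)

/-- The right-hand sides `B(δH/δq)` of the equations of motion with the Hamiltonian `H`. -/
def hamVec (B : OpMatrix K ι z) (H : Jet K ι z) : ι → Jet K ι z :=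
  fun i => (varDer H).sum fun j f => (B i j).act f

/-- The evolution field `X_H`. -/
def hamField (B : OpMatrix K ι z) (H : Jet K ι z) :
    Derivation ℤ (Jet K ι z) (Jet K ι z) :=
  evol (hamVec B H)

/-- The bracket `{H, F} = ∑ᵢⱼ (δF/δqᵢ) Bᵢⱼ (δH/δqⱼ)`. -/
def bracket (B : OpMatrix K ι z) (H F : Jet K ι z) : Jet K ι z :=
  (varDer F).sum fun i f => f * hamVec B H i

/-- Equality modulo divergences, that is, modulo the image of `∂`. -/
def EqModDiv (F G : Jet K ι z) : Prop := ∃ E : Jet K ι z, F - G = E′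

/-- A matrix of differential operators is Hamiltonian if it is skew-adjoint, its bracket satisfies
the Jacobi identity modulo divergences, and `H ↦ X_H` takes brackets to commutators of evolution
fields. -/
structure IsHamiltonian (B : OpMatrix K ι z) : Prop where
  skew : ∀ i j, (B i j).adj = -B j i
  jacobi : ∀ F G H : Jet K ι z,
    EqModDiv (bracket B H (bracket B F G) + bracket B F (bracket B G H)
      + bracket B G (bracket B H F)) 0
  hom : ∀ F H : Jet K ι z, hamField B (bracket B H F) = ⁅hamField B H, hamField B F⁆

/-! ### Quasiclassical limit -/

/-- The rescaling `∂ ↦ ε∂` on differential functions: `qᵢ^{(k)} ↦ εᵏ qᵢ^{(k)}`, with values in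
polynomials in `ε`. -/
def scale : Jet K ι z →+* Polynomial (Jet K ι z) :=
  Jet.lift (Polynomial.C.comp base) (fun i k => Polynomial.monomial k (q i k))
    (by
      rw [Polynomial.monomial_zero_left]
      exact (IsUnit.of_mul_eq_one _ (q_mul_qInv (K := K) (z := z))).map Polynomial.C)

/-- `B₀` is the quasiclassical limit of `B`: when every `∂` in `B` (also the ones inside the
coefficients) is replaced by `ε∂`, one gets `B_ε = ε B₀ + O(ε²)`. The coefficient at `∂ᵏ` of the
entries of `B_ε` is `εᵏ scale(Bᵢⱼ,ₖ)`. -/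
def IsQuasiclassicalLimit (B B₀ : OpMatrix K ι z) : Prop :=
  ∀ i j k, ∃ r : Polynomial (Jet K ι z),
    scale ((B i j).coeff k) * Polynomial.X ^ k =
      Polynomial.X * Polynomial.C ((B₀ i j).coeff k) + Polynomial.X ^ 2 * r

/-! ### Reduction of a matrix under a differential substitution -/

/-- The differential substitution `qᵢ = Ψᵢ`, that is `qᵢ^{(k)} ↦ ∂ᵏ(Ψᵢ)`. -/
def subst {κ : Type*} {w : κ} (Ψ : ι → Jet K κ w) (hΨ : IsUnit (Ψ z)) :
    Jet K ι z →+* Jet K κ w :=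
  Jet.lift base (fun i k => iter k (Ψ i)) hΨ

/-- Under the substitution `qᵢ = Ψᵢ(p)` the matrix `B` in the variables `q` reduces to the matrix
`b` in the variables `p`: after the substitution into its coefficients, `B` becomes `J b J†`, where
`J = (DΨᵢ/Dpₐ)` is the Jacobian. In other words, the substitution is a Hamiltonian map. -/
def ReducesTo {κ : Type*} [Fintype κ] {w : κ} (Ψ : ι → Jet K κ w) (hΨ : IsUnit (Ψ z))
    (B : OpMatrix K ι z) (b : OpMatrix K κ w) : Prop :=
  ∀ i j, (B i j).map (subst Ψ hΨ) =
    ∑ a, ∑ c, frechet (Ψ i) a ⊙ b a c ⊙ (frechet (Ψ j) c).adj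

end Jet

/-! ### The extended KP matrix -/

/-- The variables `A₀, A₁, A₂, …` and `φ`. -/
inductive KPVar : Type
  | A (n : ℕ)
  | φ

/-- The variables `u`, `h` and `φ`. -/
inductive LWVar : Type
  | u
  | h
  | φ
  deriving DecidableEq

instance : Fintype LWVar where
  elems := {LWVar.u, LWVar.h, LWVar.φ}
  complete := by intro x; cases x <;> simp

section Matrices

variable {K : Type*} [CommRing K] [Differential K]

/-- Differential functions of `A₀, A₁, …, φ`, with `A₀` inverted. -/
abbrev KPJet (K : Type*) [CommRing K] : Type _ := Jet K KPVar (KPVar.A 0)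

/-- Differential functions of `u, h, φ`, with `h` inverted. -/
abbrev LWJet (K : Type*) [CommRing K] : Type _ := Jet K LWVar LWVar.h

/-- The function `Aₙ`. -/
def A (n : ℕ) : KPJet K := q (KPVar.A n) 0

/-- The operator `φₓ + α φ ∂`, for a function `φ` and a scalar `α` in a differential ring. -/
def phiOp {R : Type*} [CommRing R] [Differential R] (α φ : R) : DiffOp R :=
  mulOp φ′ + mon 1 (α * φ)

/-- The operator `α ∂ φ - φₓ`. -/
def phiOp' {R : Type*} [CommRing R] [Differential R] (α φ : R) : DiffOp R :=
  mon 1 α ⊙ mulOp φ - mulOp φ′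

/-- The extended first KP Hamiltonian matrix. -/
def kpMatrix (α : K) : OpMatrix K KPVar (KPVar.A 0)
  | .A n, .A m =>
      ∑ μ ∈ Finset.range (n + m + 1),
        (mon μ ((n.choose μ : KPJet K) * A (n + m - μ))
          - negDPow (KPJet K) μ ⊙ mulOp ((m.choose μ : KPJet K) * A (n + m - μ)))
  | .φ, .A m =>
      phiOp (base α) (q .φ 0) ⊙ mulOp qInv ⊙
        ∑ s ∈ Finset.range m,
          negDPow (KPJet K) s ⊙ mulOp ((m.choose (s + 1) : KPJet K) * A (m - 1 - s))
  | .A n, .φ =>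
      (∑ s ∈ Finset.range n, mon s ((n.choose (s + 1) : KPJet K) * A (n - 1 - s))) ⊙
        mulOp qInv ⊙ phiOp' (base α) (q .φ 0)
  | .φ, .φ => 0

/-- The extended Benney (Kupershmidt--Manin) matrix. -/
def benneyMatrix (α : K) : OpMatrix K KPVar (KPVar.A 0)
  | .A n, .A m =>
      mon 1 ((n : KPJet K) * A (n + m - 1)) + mon 1 1 ⊙ mulOp ((m : KPJet K) * A (n + m - 1))
  | .φ, .A m => phiOp (base α) (q .φ 0) ⊙ mulOp ((m : KPJet K) * A (m - 1) * qInv)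
  | .A n, .φ => mulOp ((n : KPJet K) * A (n - 1) * qInv) ⊙ phiOp' (base α) (q .φ 0)
  | .φ, .φ => 0

/-- The extended long wave matrix in the variables `u, h, φ`. -/
def lwMatrix (α : K) : OpMatrix K LWVar LWVar.h
  | .u, .u => 0
  | .u, .h => mon 1 1
  | .u, .φ =>
      -mulOp (qInv * (q .φ 0)′) + mulOp (base α) ⊙ mulOp qInv ⊙ mon 1 1 ⊙ mulOp (q .φ 0)
  | .h, .u => mon 1 1
  | .h, .h => 0
  | .h, .φ => 0
  | .φ, .u =>
      mulOp (qInv * (q .φ 0)′) + mulOp (base α) ⊙ mulOp (q .φ 0) ⊙ mon 1 1 ⊙ mulOp qInv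
  | .φ, .h => 0
  | .φ, .φ => 0

/-- The differential polynomials `Qₙ(u) = (∂ + u)ⁿ(1)`. -/
def Q (n : ℕ) : LWJet K := (fun f : LWJet K => f′ + q .u 0 * f)^[n] 1

/-- The substitution `Aₙ = h Qₙ(u)`, `φ = φ`. -/
def kpToLW : KPVar → LWJet K
  | .A n => q .h 0 * Q n
  | .φ => q .φ 0

theorem isUnit_kpToLW : IsUnit (kpToLW (K := K) (KPVar.A 0)) := by
  simpa [kpToLW, Q] using IsUnit.of_mul_eq_one _ (q_mul_qInv (K := K) (z := LWVar.h))

end Matrices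

end KPExt

end

/-! A covector with components Pₙ at the Aₙ is read as the operator ∑ Pₙ∂ⁿ, and `evA` evaluates it
by ∂ⁿ ↦ Aₙ. Modulo divergences the block of the Aₙ is then the Lie–Poisson form `evA [Y, X]` of the
Lie algebra of differential operators (`tr_act_kp_AA`). A component ξ at φ acts through the
derivation `dop (slope ξ)` of the operator algebra. These derivations commute, so `kpOp` satisfies
the cyclic identity of a semidirect product with an abelian algebra (`kpAd_kpOp_cyclic`).

However, `slope` depends on A₀ and φ, so varying the form produces further terms. Both variables are
driven by one quantity, `flux`: A₀ moves by ∂(flux), and φ is transported with velocity flux/A₀.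
This makes the further terms symmetric modulo divergences (`tr_slopeVariation_symm`), and they
cancel in the cyclic sum. The criterion `IsHamiltonian.of_form` turns the vanishing cyclic sum into
all three Hamiltonian properties.

The reduction rests on D = ∂ + u. Since Qₘ = Dᵐ(1), Leibniz gives Dⁿ(Qₘ f) = ∑ (n choose l) Qₙ₊ₘ₋ₗ
f^{(l)}, which is the shape of the matrix entries; and a variation δu = g′ conjugates D
infinitesimally, so δQₙ = Dⁿ(g) - g Qₙ. The quasiclassical limit is a matter of weights: ∂ has
weight one and qᵢ^{(k)} has weight k, the weight-zero terms cancel, and those of weight one form the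
Benney matrix. -/

noncomputable section

namespace KPExt

set_option linter.unusedSectionVars false

/-! ### Leibniz rule for iterates, used with T = S = U = ∂ and with T = S = ∂ + u, U = ∂. -/

section Leibniz

/-- Leibniz rule for the iterates of additive maps with `T (a * b) = S a * b + a * U b`. -/
theorem iterate_twisted_leibniz {R : Type*} [CommRing R] (T S U : R →+ R)
    (h : ∀ a b, T (a * b) = S a * b + a * U b) (n : ℕ) (a b : R) :
    T^[n] (a * b) =
      ∑ l ∈ Finset.range (n + 1), (n.choose l : R) * (S^[n - l] a * U^[l] b) := by
  have key : T^[n] (a * b) = ∑ p ∈ Finset.HasAntidiagonal.antidiagonal n,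
      (n.choose p.1 : R) * (U^[p.1] b * S^[p.2] a) := by
    induction n with
    | zero => simp [mul_comm]
    | succ n ih =>
      rw [Function.iterate_succ_apply', ih, map_sum]
      have := Finset.sum_antidiagonal_choose_succ_mul (R := R)
        (fun i j => U^[i] b * S^[j] a) n
      rw [this, ← Finset.sum_add_distrib]
      refine Finset.sum_congr rfl fun p hp => ?_
      rw [← nsmul_eq_mul, map_nsmul, nsmul_eq_mul, mul_comm (U^[p.1] b), h,
        ← Function.iterate_succ_apply' S, ← Function.iterate_succ_apply' U,
        ← Nat.choose_symm_of_eq_add (Finset.HasAntidiagonal.mem_antidiagonal.mp hp).symm]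
      ring
  rw [key, Finset.Nat.sum_antidiagonal_eq_sum_range_succ_mk]
  exact Finset.sum_congr rfl fun l _ => by ring

end Leibniz

/-! ### Action of operators, integration modulo divergences, adjoints. -/

section DiffRing

variable {R : Type*} [CommRing R] [Differential R]

@[simp] theorem iter_zero (f : R) : iter 0 f = f := rfl

theorem iter_succ (k : ℕ) (f : R) : iter (k + 1) f = (iter k f)′ :=
  Function.iterate_succ_apply' _ _ _

theorem iter_succ' (k : ℕ) (f : R) : iter (k + 1) f = iter k f′ :=
  Function.iterate_succ_apply _ _ _

theorem iter_add_apply (k l : ℕ) (f : R) : iter (k + l) f = iter k (iter l f) :=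
  Function.iterate_add_apply _ _ _ _

@[simp] theorem iter_add (k : ℕ) (f g : R) : iter k (f + g) = iter k f + iter k g := by
  induction k with
  | zero => rfl
  | succ k ih => simp [iter_succ, ih]

/-- `iter k` as an additive map. -/
def iterHom (k : ℕ) : R →+ R := AddMonoidHom.mk' (iter k) (iter_add k)

@[simp] theorem iter_map_zero (k : ℕ) : iter k (0 : R) = 0 := (iterHom k).map_zero

@[simp] theorem iter_neg (k : ℕ) (f : R) : iter k (-f) = -iter k f := (iterHom k).map_neg f

@[simp] theorem iter_sub (k : ℕ) (f g : R) : iter k (f - g) = iter k f - iter k g :=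
  (iterHom k).map_sub f g

theorem iter_sum {κ : Type*} (k : ℕ) (s : Finset κ) (f : κ → R) :
    iter k (∑ x ∈ s, f x) = ∑ x ∈ s, iter k (f x) := map_sum (iterHom k) f s

theorem iter_natCast_mul (k n : ℕ) (f : R) : iter k ((n : R) * f) = n * iter k f := by
  have h := map_nsmul (iterHom k) n f
  rw [nsmul_eq_mul, nsmul_eq_mul] at h
  exact h

theorem iter_neg_one_pow_mul (k n : ℕ) (f : R) :
    iter k ((-1) ^ n * f) = (-1) ^ n * iter k f := by
  rcases neg_one_pow_eq_or R n with h | h <;> simp [h]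

theorem iter_mul (n : ℕ) (a b : R) :
    iter n (a * b) =
      ∑ l ∈ Finset.range (n + 1), (n.choose l : R) * (iter (n - l) a * iter l b) :=
  iterate_twisted_leibniz (Differential.deriv (R := R)).toLinearMap.toAddMonoidHom
    (Differential.deriv (R := R)).toLinearMap.toAddMonoidHom
    (Differential.deriv (R := R)).toLinearMap.toAddMonoidHom
    (fun a b => by simp; ring) n a b

/-! ### The action of operators -/

theorem act_eq_sum (P : DiffOp R) (f : R) : P.act f = P.sum fun k a => a * iter k f := rfl

@[simp] theorem act_mon (k : ℕ) (a f : R) : (mon k a).act f = a * iter k f := by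
  simp [DiffOp.act, Polynomial.sum_monomial_index]

@[simp] theorem act_mulOp (a f : R) : (mulOp a).act f = a * f := act_mon 0 a f

@[simp] theorem act_add (P Q : DiffOp R) (f : R) : (P + Q).act f = P.act f + Q.act f :=
  Polynomial.sum_add_index _ _ _ (by simp) (by intros; ring)

/-- The action on a fixed function, additive in the operator. -/
def actHom (f : R) : DiffOp R →+ R := AddMonoidHom.mk' (fun P => P.act f) fun P Q => act_add P Q f

@[simp] theorem act_zero_op (f : R) : (0 : DiffOp R).act f = 0 := (actHom f).map_zero

@[simp] theorem act_neg_op (P : DiffOp R) (f : R) : (-P).act f = -P.act f := (actHom f).map_neg P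

@[simp] theorem act_sub_op (P Q : DiffOp R) (f : R) : (P - Q).act f = P.act f - Q.act f :=
  (actHom f).map_sub P Q

@[simp] theorem act_sum_op {κ : Type*} (s : Finset κ) (P : κ → DiffOp R) (f : R) :
    (∑ x ∈ s, P x).act f = ∑ x ∈ s, (P x).act f := map_sum (actHom f) P s

theorem act_map_add (P : DiffOp R) (f g : R) : P.act (f + g) = P.act f + P.act g := by
  simp [DiffOp.act, Polynomial.sum, mul_add, Finset.sum_add_distrib]

/-- An operator as an additive map. -/
def actL (P : DiffOp R) : R →+ R := AddMonoidHom.mk' P.act (act_map_add P)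

@[simp] theorem act_map_zero (P : DiffOp R) : P.act 0 = 0 := (actL P).map_zero

@[simp] theorem act_map_neg (P : DiffOp R) (f : R) : P.act (-f) = -P.act f := (actL P).map_neg f

@[simp] theorem act_map_sub (P : DiffOp R) (f g : R) : P.act (f - g) = P.act f - P.act g :=
  (actL P).map_sub f g

theorem act_map_sum {κ : Type*} (P : DiffOp R) (s : Finset κ) (f : κ → R) :
    P.act (∑ x ∈ s, f x) = ∑ x ∈ s, P.act (f x) := map_sum (actL P) f s

-- Together with the faithfulness of the action (`diffOp_ext`), this reduces identities between
-- operators, associativity included, to a check on functions.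
@[simp] theorem act_comp (P Q : DiffOp R) (f : R) : (P ⊙ Q).act f = P.act (Q.act f) := by
  have h : ∀ (i j : ℕ) (a b : R), (∑ l ∈ Finset.range (i + 1),
      mon (i - l + j) ((i.choose l : R) * (a * iter l b))).act f =
        a * iter i (b * iter j f) := by
    intro i j a b
    rw [act_sum_op, mul_comm b, iter_mul, Finset.mul_sum]
    refine Finset.sum_congr rfl fun l _ => ?_
    rw [act_mon, iter_add_apply]
    ring
  unfold DiffOp.comp
  rw [Polynomial.sum_def, act_sum_op, act_eq_sum P, Polynomial.sum_def]
  refine Finset.sum_congr rfl fun i _ => ?_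
  rw [Polynomial.sum_def, act_sum_op, act_eq_sum Q, Polynomial.sum_def, iter_sum, Finset.mul_sum]
  exact Finset.sum_congr rfl fun j _ => h i j _ _

/-! ### Functions modulo divergences -/

variable (R) in
/-- The additive group of divergences. -/
def divergences : AddSubgroup R := (Differential.deriv (R := R)).toLinearMap.toAddMonoidHom.range

variable (R) in
/-- The quotient map to functions modulo divergences (the formal integral). -/
def tr : R →+ R ⧸ divergences R := QuotientAddGroup.mk' (divergences R)

theorem tr_eq_tr {f g : R} : tr R f = tr R g ↔ ∃ E : R, f - g = E′ := by
  rw [← sub_eq_zero, ← map_sub]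
  refine (QuotientAddGroup.eq_zero_iff _).trans ⟨?_, ?_⟩
  · rintro ⟨E, h⟩; exact ⟨E, h.symm⟩
  · rintro ⟨E, h⟩; exact ⟨E, h.symm⟩

theorem tr_eq_of_sub {f g : R} (E : R) (h : f - g = E′) : tr R f = tr R g := tr_eq_tr.mpr ⟨E, h⟩

theorem tr_mul_deriv (f g : R) : tr R (f * g′) = -tr R (f′ * g) := by
  rw [← map_neg]
  exact tr_eq_of_sub (f * g) (by simp; ring)

theorem tr_mul_iter (k : ℕ) (f g : R) : tr R (f * iter k g) = tr R ((-1) ^ k * iter k f * g) := by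
  induction k generalizing f with
  | zero => simp
  | succ k ih =>
    rw [iter_succ, tr_mul_deriv, ih, ← map_neg, iter_succ']
    congr 1
    ring

theorem act_adj (P : DiffOp R) (g : R) :
    P.adj.act g = P.sum fun k a => (-1) ^ k * iter k (a * g) := by
  unfold DiffOp.adj
  rw [Polynomial.sum_def, act_sum_op, Polynomial.sum_def]
  exact Finset.sum_congr rfl fun k _ => by simp

theorem tr_act_adj (P : DiffOp R) (f g : R) : tr R (g * P.act f) = tr R (f * P.adj.act g) := by
  rw [act_adj, act_eq_sum, Polynomial.sum_def, Polynomial.sum_def, Finset.mul_sum, Finset.mul_sum,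
    map_sum, map_sum]
  refine Finset.sum_congr rfl fun k _ => ?_
  rw [← mul_assoc, tr_mul_iter]
  congr 1
  rw [mul_comm g]
  ring

end DiffRing

/-! ### Variational calculus on differential functions. -/

section JetCalculus

variable {K : Type*} [CommRing K] {ι : Type*} {z : ι}

theorem Jet.derivation_ext {D E : Derivation ℤ (Jet K ι z) (Jet K ι z)}
    (hb : ∀ a, D (base a) = E (base a)) (hq : ∀ i k, D (q i k) = E (q i k)) : D = E := by
  -- A derivation D is encoded as the ring homomorphism F ↦ F + ε D(F) to the dual numbers, so that
  -- `Jet.hom_ext` applies.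
  let f : Derivation ℤ (Jet K ι z) (Jet K ι z) → (Jet K ι z →+* DualNumber (Jet K ι z)) := fun D =>
    { toFun := fun F => TrivSqZeroExt.inl F + TrivSqZeroExt.inr (D F)
      map_one' := by ext <;> simp
      map_zero' := by ext <;> simp
      map_add' := fun a b => by ext <;> simp
      map_mul' := fun a b => by ext <;> simp [mul_comm] }
  have h : f D = f E := Jet.hom_ext (fun a => by simp [f, hb]) (fun i k => by simp [f, hq])
  ext F
  have := congrArg (fun g : Jet K ι z →+* DualNumber (Jet K ι z) => (g F).snd) h
  simpa [f] using this

@[simp] theorem pd_base (i : ι) (k : ℕ) (a : K) : pd i k (base a : Jet K ι z) = 0 := by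
  simp [pd]

open scoped Classical in
theorem pd_q (i j : ι) (k l : ℕ) :
    pd i k (q j l : Jet K ι z) = if j = i ∧ l = k then 1 else 0 := by
  simp [pd]

theorem pd_q_self (i : ι) (k : ℕ) : pd i k (q i k : Jet K ι z) = 1 := by simp [pd_q]

theorem pd_comm (i j : ι) (k l : ℕ) (F : Jet K ι z) : pd i k (pd j l F) = pd j l (pd i k F) := by
  have : ⁅pd (K := K) (ι := ι) (z := z) i k, pd (K := K) (ι := ι) (z := z) j l⁆ = 0 := by
    apply Jet.derivation_ext
    · intro a; simp [Derivation.commutator_apply]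
    · intro a m
      simp only [Derivation.commutator_apply, pd_q]
      split_ifs <;> simp
  have h := congrArg (fun D : Derivation ℤ (Jet K ι z) (Jet K ι z) => D F) this
  simpa [Derivation.commutator_apply, sub_eq_zero] using h

@[simp] theorem grad_apply (F : Jet K ι z) (p : ι × ℕ) : grad F p = pd p.1 p.2 F := rfl

theorem grad_add (F G : Jet K ι z) : grad (F + G) = grad F + grad G := by ext p; simp

theorem grad_mul (F G : Jet K ι z) : grad (F * G) = F • grad G + G • grad F := by ext p; simp

/-- The chain rule. -/
theorem derivation_eq_sum_grad (D : Derivation ℤ (Jet K ι z) (Jet K ι z))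
    (hD : ∀ a, D (base a) = 0) (F : Jet K ι z) :
    D F = (grad F).sum fun p a => a * D (q p.1 p.2) := by
  let E : Derivation ℤ (Jet K ι z) (Jet K ι z) := Derivation.mk'
    { toFun := fun F => Finsupp.linearCombination (Jet K ι z)
        (fun p : ι × ℕ => D (q p.1 p.2)) (grad F)
      map_add' := fun F G => by rw [grad_add, map_add]
      map_smul' := fun n F => by
        have : grad (n • F) = n • grad F := by ext p; simp
        rw [this, map_zsmul]; rfl }
    (fun F G => by
      simp only [LinearMap.coe_mk, AddHom.coe_mk, grad_mul, map_add, map_smul])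
  have h : D = E := by
    apply Jet.derivation_ext
    · intro a
      have : grad (base a : Jet K ι z) = 0 := by ext p; simp
      simp [E, hD, this]
    · intro i k
      have : grad (q i k : Jet K ι z) = Finsupp.single (i, k) 1 := by
        classical
        ext p
        simp only [grad_apply, pd_q, Finsupp.single_apply, Prod.ext_iff]
      simp [E, this]
  exact congrArg (fun D : Derivation ℤ (Jet K ι z) (Jet K ι z) => D F) h

@[simp] theorem evol_base (V : ι → Jet K ι z) [Differential K] (a : K) : evol V (base a) = 0 := by
  simp [evol]

variable [Differential K]

@[simp] theorem evol_q (V : ι → Jet K ι z) (i : ι) (k : ℕ) : evol V (q i k) = iter k (V i) := by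
  simp [evol]

@[simp] theorem deriv_base (a : K) : (base a : Jet K ι z)′ = base a′ :=
  mkDer_base _ _ a

@[simp] theorem deriv_q (i : ι) (k : ℕ) : (q i k : Jet K ι z)′ = q i (k + 1) :=
  mkDer_q _ _ i k

theorem iter_q (i : ι) (k l : ℕ) : iter k (q i l : Jet K ι z) = q i (l + k) := by
  induction k with
  | zero => rfl
  | succ k ih => rw [iter_succ, ih, deriv_q, add_assoc]

theorem evol_deriv (V : ι → Jet K ι z) (F : Jet K ι z) : evol V F′ = (evol V F)′ := by
  have : ⁅evol V, Differential.deriv (R := Jet K ι z)⁆ = 0 := by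
    apply Jet.derivation_ext
    · intro a; simp [Derivation.commutator_apply]
    · intro a m; simp [Derivation.commutator_apply, iter_succ]
  have h := congrArg (fun D : Derivation ℤ (Jet K ι z) (Jet K ι z) => D F) this
  simpa [Derivation.commutator_apply, sub_eq_zero] using h

theorem evol_iter (V : ι → Jet K ι z) (k : ℕ) (F : Jet K ι z) :
    evol V (iter k F) = iter k (evol V F) := by
  induction k with
  | zero => rfl
  | succ k ih => rw [iter_succ, evol_deriv, ih, iter_succ]

theorem tr_evol_congr (V : ι → Jet K ι z) {F G : Jet K ι z} (h : tr _ F = tr _ G) :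
    tr _ (evol V F) = tr _ (evol V G) := by
  obtain ⟨E, hE⟩ := tr_eq_tr.mp h
  exact tr_eq_of_sub (evol V E) (by rw [← map_sub, hE, evol_deriv])

theorem pd_succ_deriv (i : ι) (k : ℕ) (F : Jet K ι z) :
    pd i (k + 1) F′ = (pd i (k + 1) F)′ + pd i k F := by
  have : ⁅pd (K := K) (ι := ι) (z := z) i (k + 1), Differential.deriv (R := Jet K ι z)⁆ = pd i k := by
    apply Jet.derivation_ext
    · intro a; simp [Derivation.commutator_apply]
    · intro a m
      rw [Derivation.commutator_apply, deriv_q, pd_q, pd_q, pd_q]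
      by_cases h : a = i ∧ m = k
      · rw [if_pos ⟨h.1, by omega⟩, if_pos h]
        split_ifs <;> simp
      · rw [if_neg (fun h' => h ⟨h'.1, by omega⟩), if_neg h]
        split_ifs <;> simp
  have h := congrArg (fun D : Derivation ℤ (Jet K ι z) (Jet K ι z) => D F) this
  rw [← h, Derivation.commutator_apply]
  ring

theorem exists_order (F : Jet K ι z) : ∃ N, ∀ i, ∀ k ≥ N, pd i k F = 0 := by
  obtain ⟨N, hN⟩ := ((finite_pd F).image Prod.snd).bddAbove
  refine ⟨N + 1, fun i k hk => ?_⟩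
  by_contra h
  have := hN ⟨(i, k), h, rfl⟩
  simp only at this
  omega

/-- If `∂E` does not depend on `qᵢ^{(k)}` for `k > N`, then `E` does not for `k ≥ N`. -/
theorem pd_eq_zero_of_deriv {i : ι} {N : ℕ} {E : Jet K ι z}
    (h : ∀ k > N, pd i k E′ = 0) : ∀ k ≥ N, pd i k E = 0 := by
  obtain ⟨M, hM⟩ := exists_order E
  -- Descending induction from a bound M on the order of E; j bounds the distance from k up to M.
  have key : ∀ j k, N ≤ k → M ≤ k + j → pd i k E = 0 := by
    intro j
    induction j with
    | zero => intro k _ hk; exact hM i k (by omega)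
    | succ j ih =>
      intro k hk hj
      have h1 := h (k + 1) (by omega)
      rw [pd_succ_deriv, ih (k + 1) (by omega) (by omega)] at h1
      simpa using h1
  intro k hk
  exact key M k hk (by omega)

/-- Nondegeneracy of the pairing `(f, g) ↦ ∫ f g`. -/
theorem eq_zero_of_tr_mul [Algebra ℚ K] (a : Jet K ι z) (h : ∀ f, tr _ (f * a) = 0) : a = 0 := by
  obtain ⟨N, hN⟩ := exists_order a
  -- The test function is the square of a coordinate above the order of a. If its product with a is
  -- ∂E, then E has order at most N in q_z.
  have h1 := h (q z (N + 1) * q z (N + 1))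
  rw [← map_zero (tr (Jet K ι z)), tr_eq_tr, sub_zero] at h1
  obtain ⟨E, hE⟩ := h1
  have hE0 := pd_eq_zero_of_deriv (i := z) (N := N + 1) (E := E) (by
    intro k hk
    rw [← hE]
    have : pd z k (q z (N + 1) : Jet K ι z) = 0 := by
      rw [pd_q, if_neg]; rintro ⟨_, h⟩; omega
    simp [this, hN z k (by omega)])
  -- A total derivative is affine in its top coordinate, whereas the second derivative of the
  -- product in that coordinate is 2a.
  have h2 : pd z (N + 1) (pd z (N + 1) E′) = 0 := by
    rw [pd_succ_deriv, hE0 (N + 1) le_rfl, map_zero, zero_add, pd_comm, hE0 (N + 1) le_rfl, map_zero]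
  rw [← hE] at h2
  simp only [Derivation.leibniz, pd_q_self, hN z (N + 1) (by omega), smul_eq_mul, map_add,
    mul_zero, mul_one, zero_add, add_zero] at h2
  have h3 : (base (algebraMap ℚ K (1 / 2)) : Jet K ι z) * 2 = 1 := by
    rw [← map_ofNat (base : K →+* Jet K ι z) 2, ← map_mul, ← map_ofNat (algebraMap ℚ K) 2,
      ← map_mul]
    norm_num
  calc a = (base (algebraMap ℚ K (1 / 2)) * 2) * a := by rw [h3, one_mul]
    _ = base (algebraMap ℚ K (1 / 2)) * (a + a) := by ring
    _ = 0 := by rw [show a + a = a * (1 + 1) by ring, h2, mul_zero]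

/-- Differential operators over the ring of differential functions act faithfully. -/
theorem diffOp_ext {P Q : DiffOp (Jet K ι z)} (h : ∀ f, P.act f = Q.act f) : P = Q := by
  have key : ∀ P : DiffOp (Jet K ι z), (∀ f, P.act f = 0) → P = 0 := by
    intro P hP
    have hord : ∃ N, ∀ j ∈ P.support, ∀ k ≥ N, pd z k (P.coeff j) = 0 := by
      choose N hN using fun j => exists_order (P.coeff j)
      refine ⟨P.support.sup N, fun j hj k hk => hN j z k ?_⟩
      exact (Finset.le_sup (f := N) hj).trans hk
    obtain ⟨N, hN⟩ := hord
    ext j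
    -- Beyond the orders of all coefficients, q_z^{(N+j)} enters P(q_z^{(N)}) only through the term
    -- with ∂ʲ, so this partial derivative extracts that coefficient.
    have h1 := congrArg (pd z (N + j)) (hP (q z N))
    rw [act_eq_sum, Polynomial.sum_def, map_sum, map_zero] at h1
    rw [Finset.sum_congr rfl (g := fun k => if k = j then P.coeff k else 0)] at h1
    · rw [Finset.sum_ite_eq'] at h1
      split_ifs at h1 with hj
      · simpa using h1
      · simpa using hj
    · intro k hk
      rw [Derivation.leibniz, hN k hk _ (by omega), iter_q, pd_q]
      by_cases hkj : k = j <;> simp [hkj]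
  rw [← sub_eq_zero]
  exact key _ fun f => by simp [h]

theorem diffOp_ext_tr [Algebra ℚ K] {P Q : DiffOp (Jet K ι z)}
    (h : ∀ f g, tr _ (g * P.act f) = tr _ (g * Q.act f)) : P = Q := by
  refine diffOp_ext fun f => sub_eq_zero.mp (eq_zero_of_tr_mul _ fun g => ?_)
  rw [mul_sub, map_sub, h, sub_self]

theorem adj_eq_of_tr [Algebra ℚ K] {P Q : DiffOp (Jet K ι z)}
    (h : ∀ f g, tr _ (g * P.act f) = tr _ (f * Q.act g)) : P.adj = Q :=
  diffOp_ext_tr fun f g => by rw [← tr_act_adj, h]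

theorem act_frechet (F : Jet K ι z) (i : ι) (f : Jet K ι z) [DecidableEq ι] :
    (frechet F i).act f = evol (Pi.single i f) F := by
  classical
  rw [derivation_eq_sum_grad _ (evol_base _) F, frechet]
  simp only [Finsupp.sum, act_sum_op]
  refine Finset.sum_congr rfl fun p _ => ?_
  rw [evol_q]
  by_cases h : p.1 = i
  · subst h; simp
  · simp [h]

/-! ### Covectors -/

/-- The pairing of a vector field with a covector. -/
def pair (V : ι → Jet K ι z) (X : ι →₀ Jet K ι z) : Jet K ι z := X.sum fun i f => f * V i

/-- The value of a matrix of operators on a covector. -/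
def app (B : OpMatrix K ι z) (X : ι →₀ Jet K ι z) : ι → Jet K ι z :=
  fun i => X.sum fun j f => (B i j).act f

/-- A derivation applied to the components of a covector. -/
def mapCov (D : Derivation ℤ (Jet K ι z) (Jet K ι z)) (X : ι →₀ Jet K ι z) : ι →₀ Jet K ι z :=
  X.mapRange D (map_zero D)

@[simp] theorem mapCov_apply (D : Derivation ℤ (Jet K ι z) (Jet K ι z)) (X : ι →₀ Jet K ι z)
    (i : ι) : mapCov D X i = D (X i) := rfl

@[simp] theorem pair_single (V : ι → Jet K ι z) (i : ι) (f : Jet K ι z) :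
    pair V (Finsupp.single i f) = f * V i := by simp [pair]

theorem pair_add (V : ι → Jet K ι z) (X Y : ι →₀ Jet K ι z) :
    pair V (X + Y) = pair V X + pair V Y :=
  Finsupp.sum_add_index' (by simp) (by intros; ring)

@[simp] theorem pair_zero (V : ι → Jet K ι z) : pair V 0 = 0 := by simp [pair]

theorem pair_add_left (V W : ι → Jet K ι z) (X : ι →₀ Jet K ι z) :
    pair (V + W) X = pair V X + pair W X := by
  simp [pair, mul_add, Finsupp.sum_add]

theorem pair_sub_left (V W : ι → Jet K ι z) (X : ι →₀ Jet K ι z) :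
    pair (V - W) X = pair V X - pair W X := by
  rw [eq_sub_iff_add_eq, ← pair_add_left, sub_add_cancel]

theorem app_add (B : OpMatrix K ι z) (X Y : ι →₀ Jet K ι z) :
    app B (X + Y) = app B X + app B Y := by
  funext i
  exact Finsupp.sum_add_index' (by simp) (by intros; exact act_map_add _ _ _)

@[simp] theorem app_zero (B : OpMatrix K ι z) : app B 0 = 0 := by
  funext i; simp [app]

@[simp] theorem app_single (B : OpMatrix K ι z) (i j : ι) (f : Jet K ι z) :
    app B (Finsupp.single j f) i = (B i j).act f := by simp [app]

theorem derivation_pair (D : Derivation ℤ (Jet K ι z) (Jet K ι z)) (V : ι → Jet K ι z)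
    (X : ι →₀ Jet K ι z) :
    D (pair V X) = pair (fun i => D (V i)) X + pair V (mapCov D X) := by
  rw [pair, pair, pair, mapCov, Finsupp.sum_mapRange_index (by simp), ← Finsupp.sum_add,
    map_finsuppSum]
  simp only [Derivation.leibniz, smul_eq_mul, mul_comm]

theorem pair_nondegenerate [Algebra ℚ K] {V W : ι → Jet K ι z}
    (h : ∀ X, tr _ (pair V X) = tr _ (pair W X)) : V = W := by
  funext i
  refine sub_eq_zero.mp (eq_zero_of_tr_mul _ fun f => ?_)
  have := h (Finsupp.single i f)
  rw [pair_single, pair_single] at this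
  rw [mul_sub, map_sub, this, sub_self]

/-- The first variation formula. -/
theorem tr_evol (V : ι → Jet K ι z) (F : Jet K ι z) :
    tr _ (evol V F) = tr _ (pair V (varDer F)) := by
  rw [derivation_eq_sum_grad _ (evol_base _) F, varDer, Finsupp.sum, Finsupp.sum, map_sum]
  have hs : ∀ s : Finset (ι × ℕ), ∀ X : ι × ℕ → (ι →₀ Jet K ι z),
      pair V (∑ p ∈ s, X p) = ∑ p ∈ s, pair V (X p) := fun s X =>
    map_sum (AddMonoidHom.mk' (pair V) (pair_add V)) X s
  rw [hs, map_sum]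
  refine Finset.sum_congr rfl fun p _ => ?_
  rw [evol_q, tr_mul_iter, pair_single]

theorem evol_commutator (V W : ι → Jet K ι z) :
    ⁅evol V, evol W⁆ = evol fun i => evol V (W i) - evol W (V i) := by
  apply Jet.derivation_ext
  · intro a; simp [Derivation.commutator_apply]
  · intro i k; simp [Derivation.commutator_apply, evol_iter]

/-- The linearization of the variational derivative is self-adjoint. -/
theorem tr_pair_evol_varDer (V W : ι → Jet K ι z) (F : Jet K ι z) :
    tr _ (pair V (mapCov (evol W) (varDer F))) = tr _ (pair W (mapCov (evol V) (varDer F))) := by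
  have h : ∀ V W : ι → Jet K ι z, tr _ (evol W (evol V F)) =
      tr _ (pair (fun i => evol W (V i)) (varDer F)) +
        tr _ (pair V (mapCov (evol W) (varDer F))) := fun V W => by
    rw [tr_evol_congr W (tr_evol V F), derivation_pair, map_add]
  -- The two orders of differentiation of F differ by the commutator field. Its first variation
  -- accounts for the terms where V and W are differentiated, leaving the symmetry of the others.
  have h1 := congrArg (tr (Jet K ι z))
    (congrArg (fun D : Derivation ℤ (Jet K ι z) (Jet K ι z) => D F) (evol_commutator V W))
  simp only [Derivation.commutator_apply] at h1
  rw [map_sub, h W V, h V W, tr_evol] at h1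
  have h2 := pair_sub_left (fun i => evol V (W i)) (fun i => evol W (V i)) (varDer F)
  rw [Pi.sub_def] at h2
  rw [h2, map_sub] at h1
  rw [← sub_eq_zero] at h1 ⊢
  rw [← neg_eq_zero, ← h1]
  abel

end JetCalculus

/-! ### A Hamiltonian criterion for forms known modulo divergences. -/

section Criterion

variable {K : Type*} [CommRing K] [Differential K] [Algebra ℚ K] {ι : Type*} {z : ι}

theorem tr_pair_app_skew {B : OpMatrix K ι z}
    (hB : ∀ i j f g, tr _ (g * (B i j).act f) = -tr _ (f * (B j i).act g))
    (X Y : ι →₀ Jet K ι z) : tr _ (pair (app B X) Y) = -tr _ (pair (app B Y) X) := by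
  induction X using Finsupp.induction_linear with
  | zero => simp [pair]
  | add X X' h h' => rw [app_add, pair_add_left, pair_add, map_add, map_add, h, h']; abel
  | single j f =>
    induction Y using Finsupp.induction_linear with
    | zero => simp [pair]
    | add Y Y' h h' => rw [app_add, pair_add_left, pair_add, map_add, map_add, h, h']; abel
    | single i g => simp [hB i j f g]

/-- The change of the form `S` along the evolution field with the components `app B W`. -/
def formVariation (B : OpMatrix K ι z) (S : (ι →₀ Jet K ι z) → (ι →₀ Jet K ι z) → Jet K ι z)
    (W X Y : ι →₀ Jet K ι z) : Jet K ι z :=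
  evol (app B W) (S X Y) - S (mapCov (evol (app B W)) X) Y - S X (mapCov (evol (app B W)) Y)

variable {B : OpMatrix K ι z} {S : (ι →₀ Jet K ι z) → (ι →₀ Jet K ι z) → Jet K ι z}

theorem tr_evol_pair_app (hS : ∀ X Y, tr _ (S X Y) = tr _ (pair (app B X) Y))
    (W X Y : ι →₀ Jet K ι z) :
    tr _ (evol (app B W) (pair (app B X) Y)) = tr _ (formVariation B S W X Y) +
      tr _ (pair (app B (mapCov (evol (app B W)) X)) Y) +
      tr _ (pair (app B X) (mapCov (evol (app B W)) Y)) := by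
  rw [tr_evol_congr _ (hS X Y).symm, formVariation, map_sub, map_sub, hS, hS]
  abel

/-- Both sides are paired with an arbitrary Y. By skewness the left side becomes minus the variation
of {H, F} along BY. Self-adjointness of the linearized variational derivative trades the variations
of δH and δF along BY for variations along the Hamiltonian fields, which match those on the right.
What remains is the cyclic sum of `formVariation`. -/
theorem hamVec_bracket
    (hB : ∀ i j f g, tr _ (g * (B i j).act f) = -tr _ (f * (B j i).act g))
    (hS : ∀ X Y, tr _ (S X Y) = tr _ (pair (app B X) Y))
    (hcyc : ∀ X Y W, tr _ (formVariation B S W X Y) + tr _ (formVariation B S X Y W) +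
      tr _ (formVariation B S Y W X) = 0) (F H : Jet K ι z) :
    hamVec B (bracket B H F) =
      fun i => hamField B H (hamVec B F i) - hamField B F (hamVec B H i) := by
  apply pair_nondegenerate
  intro Y
  have hsk := tr_pair_app_skew hB
  have hanti : ∀ W X Y, tr _ (formVariation B S W X Y) = -tr _ (formVariation B S W Y X) := by
    intro W X Y
    have h1 := tr_evol_pair_app hS W X Y
    have h2 := tr_evol_pair_app hS W Y X
    have h3 : tr _ (evol (app B W) (pair (app B X) Y)) =
        -tr _ (evol (app B W) (pair (app B Y) X)) := by
      rw [← map_neg, ← map_neg]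
      exact tr_evol_congr _ (by rw [map_neg, hsk])
    rw [h1, h2, hsk (mapCov _ X) Y, hsk X (mapCov _ Y)] at h3
    rw [← sub_eq_zero] at h3 ⊢
    rw [← h3]
    abel
  have hL : tr _ (pair (hamVec B (bracket B H F)) Y) =
      -tr _ (evol (app B Y) (pair (app B (varDer H)) (varDer F))) := by
    change tr _ (pair (app B (varDer (bracket B H F))) Y) = _
    rw [hsk, ← tr_evol]
    rfl
  rw [hL, tr_evol_pair_app hS, hsk (mapCov _ _), tr_pair_evol_varDer (app B (varDer F)),
    tr_pair_evol_varDer (app B (varDer H))]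
  have hR : ∀ F H : Jet K ι z, tr _ (pair (fun i => hamField B H (hamVec B F i)) Y) =
      tr _ (formVariation B S (varDer H) (varDer F) Y) +
        tr _ (pair (app B (mapCov (evol (app B (varDer H))) (varDer F))) Y) := by
    intro F H
    have h1 := tr_evol_pair_app hS (varDer H) (varDer F) Y
    rw [derivation_pair, map_add] at h1
    exact add_right_cancel h1
  have hsplit := pair_sub_left (fun i => hamField B H (hamVec B F i))
    (fun i => hamField B F (hamVec B H i)) Y
  rw [Pi.sub_def] at hsplit
  rw [hsplit, map_sub, hR, hR, hsk (mapCov _ _) Y, hsk (mapCov _ _) Y]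
  have hc := hcyc (varDer H) (varDer F) Y
  rw [hanti (varDer F) Y] at hc
  rw [← sub_eq_zero, ← neg_eq_zero, ← hc]
  abel

/-- A criterion for a matrix of operators to be Hamiltonian. The bilinear form of the matrix may be
computed modulo divergences. -/
theorem IsHamiltonian.of_form
    (hB : ∀ i j f g, tr _ (g * (B i j).act f) = -tr _ (f * (B j i).act g))
    (hS : ∀ X Y, tr _ (S X Y) = tr _ (pair (app B X) Y))
    (hcyc : ∀ X Y W, tr _ (formVariation B S W X Y) + tr _ (formVariation B S X Y W) +
      tr _ (formVariation B S Y W X) = 0) : IsHamiltonian B := by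
  have hhom : ∀ F H : Jet K ι z, hamField B (bracket B H F) = ⁅hamField B H, hamField B F⁆ := by
    intro F H
    rw [hamField, hamVec_bracket hB hS hcyc, hamField, hamField, evol_commutator]
  have hbr : ∀ F G : Jet K ι z, tr _ (bracket B F G) = tr _ (hamField B F G) := fun F G =>
    (tr_evol _ _).symm
  have hbrskew : ∀ F G : Jet K ι z, tr _ (bracket B F G) = tr _ (-bracket B G F) := fun F G => by
    rw [map_neg]
    exact tr_pair_app_skew hB _ _
  have hcongr : ∀ F G G' : Jet K ι z, tr _ G = tr _ G' →
      tr _ (hamField B F G) = tr _ (hamField B F G') := fun F G G' h => tr_evol_congr _ h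
  refine ⟨fun i j => adj_eq_of_tr fun f g => ?_, fun F G H => ?_, hhom⟩
  · rw [hB, act_neg_op, mul_neg, map_neg]
  -- Modulo divergences {F, G} is X_F(G), so the three terms are X_H X_F G, -X_F X_H G and
  -- -X_{{H,F}} G; they add up to zero by `hhom`.
  · rw [EqModDiv, ← tr_eq_tr, map_zero, map_add, map_add, hbr H, hcongr H _ _ (hbr F G), hbr F,
      hcongr F _ _ (hbrskew G H), map_neg, map_neg, hcongr F _ _ (hbr H G), hbrskew G, map_neg,
      hbr (bracket B H F), hhom, Derivation.commutator_apply, map_sub]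
    abel

end Criterion

/-! ### Commutators of operators and the derivations ∂ ↦ a. -/

section OperatorAlgebra

variable {K : Type*} [CommRing K] [Differential K] {ι : Type*} {z : ι}

/-- The commutator of operators. -/
def comm {R : Type*} [CommRing R] [Differential R] (P Q : DiffOp R) : DiffOp R := P ⊙ Q - Q ⊙ P

theorem comp_mon {R : Type*} [CommRing R] [Differential R] (i j : ℕ) (a b : R) :
    mon i a ⊙ mon j b =
      ∑ l ∈ Finset.range (i + 1), mon (i - l + j) ((i.choose l : R) * (a * iter l b)) := by
  unfold DiffOp.comp
  rw [Polynomial.sum_monomial_index, Polynomial.sum_monomial_index] <;> simp [Polynomial.sum]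

theorem comp_add (P Q Q' : DiffOp (Jet K ι z)) : P ⊙ (Q + Q') = P ⊙ Q + P ⊙ Q' :=
  diffOp_ext fun f => by simp [act_map_add]

theorem add_comp (P P' Q : DiffOp (Jet K ι z)) : (P + P') ⊙ Q = P ⊙ Q + P' ⊙ Q :=
  diffOp_ext fun f => by simp

theorem mulOp_comp_mon (a b : Jet K ι z) (m : ℕ) : mulOp a ⊙ mon m b = mon m (a * b) :=
  diffOp_ext fun f => by simp [mul_assoc]

theorem deriv_comp_mon (b : Jet K ι z) (m : ℕ) :
    mon 1 1 ⊙ mon m b = mon (m + 1) b + mon m b′ :=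
  diffOp_ext fun f => by simp [iter_succ]; ring

@[elab_as_elim]
theorem diffOp_induction {p : DiffOp (Jet K ι z) → Prop} (P : DiffOp (Jet K ι z))
    (add : ∀ P Q, p P → p Q → p (P + Q)) (mul : ∀ f P, p P → p (mulOp f ⊙ P))
    (deriv : ∀ P, p P → p (mon 1 1 ⊙ P)) (one : p (mulOp 1)) : p P := by
  induction P using Polynomial.induction_on' with
  | add P Q hP hQ => exact add P Q hP hQ
  | monomial n a =>
    have h : p (mon n 1) := by
      induction n with
      | zero => exact one
      | succ n ih =>
        have h1 : mon 1 1 ⊙ mon n 1 = mon (n + 1) (1 : Jet K ι z) :=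
          diffOp_ext fun f => by simp [iter_succ]
        exact h1 ▸ deriv _ ih
    have := mul a _ h
    rwa [mulOp_comp_mon, mul_one] at this

theorem comm_jacobi (P Q W : DiffOp (Jet K ι z)) :
    comm (comm P Q) W + comm (comm Q W) P + comm (comm W P) Q = 0 :=
  diffOp_ext fun f => by simp [comm]; abel

/-- The derivation of the algebra of operators that kills the functions and maps `∂` to `a`.
If `a = b′`, then it is the commutator with `b`. -/
def dop (a : Jet K ι z) : DiffOp (Jet K ι z) →ₗ[Jet K ι z] DiffOp (Jet K ι z) :=
  Polynomial.lsum fun m => ∑ s ∈ Finset.range m,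
    (Polynomial.monomial (m - 1 - s)).comp
      (LinearMap.mulLeft _ ((m.choose (s + 1) : Jet K ι z) * iter s a))

theorem dop_mon (a : Jet K ι z) (m : ℕ) (c : Jet K ι z) :
    dop a (mon m c) =
      ∑ s ∈ Finset.range m, mon (m - 1 - s) ((m.choose (s + 1) : Jet K ι z) * iter s a * c) := by
  simp [dop, Polynomial.sum_monomial_index, mul_assoc]

theorem dop_add_left (a b : Jet K ι z) (P : DiffOp (Jet K ι z)) :
    dop (a + b) P = dop a P + dop b P := by
  induction P using Polynomial.induction_on' with
  | add P Q hP hQ => rw [map_add, map_add, map_add, hP, hQ]; abel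
  | monomial n c =>
    have := dop_mon (a + b) n c
    rw [this, dop_mon, dop_mon, ← Finset.sum_add_distrib]
    exact Finset.sum_congr rfl fun s _ => by rw [← map_add, iter_add]; congr 1; ring

theorem dop_sub_left (a b : Jet K ι z) (P : DiffOp (Jet K ι z)) :
    dop (a - b) P = dop a P - dop b P := by
  rw [eq_sub_iff_add_eq, ← dop_add_left, sub_add_cancel]

@[simp] theorem dop_zero_left (P : DiffOp (Jet K ι z)) : dop (0 : Jet K ι z) P = 0 := by
  have := dop_sub_left (0 : Jet K ι z) 0 P
  rwa [sub_zero, sub_self] at this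

theorem dop_mulOp_comp (a f : Jet K ι z) (P : DiffOp (Jet K ι z)) :
    dop a (mulOp f ⊙ P) = mulOp f ⊙ dop a P := by
  have h : ∀ Q : DiffOp (Jet K ι z), mulOp f ⊙ Q = f • Q := fun Q => by
    induction Q using Polynomial.induction_on' with
    | add P Q hP hQ => rw [comp_add, hP, hQ, smul_add]
    | monomial n c => rw [mulOp_comp_mon, Polynomial.smul_monomial, smul_eq_mul]
  rw [h, h, map_smul]

theorem dop_deriv_comp (a : Jet K ι z) (P : DiffOp (Jet K ι z)) :
    dop a (mon 1 1 ⊙ P) = mulOp a ⊙ P + mon 1 1 ⊙ dop a P := by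
  induction P using Polynomial.induction_on' with
  | add P Q hP hQ => rw [comp_add, map_add, map_add, comp_add, comp_add, hP, hQ]; abel
  | monomial m c =>
    have hm := dop_mon a m c
    rw [deriv_comp_mon, map_add, dop_mon, dop_mon, hm]
    refine diffOp_ext fun f => ?_
    simp only [act_add, act_sum_op, act_mon, act_comp, act_mulOp, iter_succ, iter_zero, map_sum,
      Derivation.leibniz, smul_eq_mul, one_mul, Derivation.map_natCast, mul_zero, add_zero]
    -- Pascal's rule splits each term in two. The leading term a·c·∂ᵐ separates, and the rest is ∂
    -- acting on `dop a` of the monomial, less the derivative of c.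
    have h1 : ∑ s ∈ Finset.range (m + 1),
        ((m + 1).choose (s + 1) : Jet K ι z) * iter s a * c * iter (m + 1 - 1 - s) f =
        a * (c * iter m f) + ∑ s ∈ Finset.range m,
          ((m.choose (s + 1) : Jet K ι z) * iter (s + 1) a * c * iter (m - 1 - s) f +
          (m.choose (s + 1) : Jet K ι z) * iter s a * c * iter (m - 1 - s + 1) f) := by
      have h2 : ∀ s, ((m + 1).choose (s + 1) : Jet K ι z) * iter s a * c * iter (m + 1 - 1 - s) f =
          (m.choose s : Jet K ι z) * iter s a * c * iter (m - s) f +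
          (m.choose (s + 1) : Jet K ι z) * iter s a * c * iter (m - s) f := fun s => by
        rw [Nat.choose_succ_succ, Nat.cast_add, Nat.add_sub_cancel]; ring
      simp only [h2]
      rw [Finset.sum_add_distrib, Finset.sum_range_succ', Finset.sum_range_succ _ m,
        Nat.choose_succ_self, Finset.sum_add_distrib]
      have h3 : ∀ s ∈ Finset.range m, m - 1 - s + 1 = m - s := fun s hs => by
        have := Finset.mem_range.mp hs; omega
      rw [Finset.sum_congr (s₁ := Finset.range m) rfl (f := fun s =>
        (m.choose (s + 1) : Jet K ι z) * iter s a * c * iter (m - 1 - s + 1) f)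
        fun s hs => by rw [h3 s hs]]
      rw [Finset.sum_congr (s₁ := Finset.range m) rfl (f := fun s =>
        (m.choose (s + 1) : Jet K ι z) * iter (s + 1) a * c * iter (m - (s + 1)) f)
        fun s hs => by rw [Nat.sub_add_eq, Nat.sub_right_comm]]
      simp only [Nat.choose_zero_right, Nat.cast_one, Nat.sub_zero, iter_zero, Nat.cast_zero]
      ring
    rw [h1, add_assoc, ← Finset.sum_add_distrib]
    congr 1
    refine Finset.sum_congr rfl fun s _ => ?_
    rw [iter_succ, iter_succ]
    ring

/-- Functions and ∂ generate all operators by left multiplication, so the product rule only needs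
the two generating cases already established. -/
theorem dop_comp (a : Jet K ι z) (P Q : DiffOp (Jet K ι z)) :
    dop a (P ⊙ Q) = dop a P ⊙ Q + P ⊙ dop a Q := by
  have assoc : ∀ P Q W : DiffOp (Jet K ι z), (P ⊙ Q) ⊙ W = P ⊙ Q ⊙ W := fun P Q W =>
    diffOp_ext fun f => by simp
  induction P using diffOp_induction with
  | add P P' h h' => rw [add_comp, map_add, map_add, h, h', add_comp, add_comp]; abel
  | mul f P h => rw [assoc, dop_mulOp_comp, h, dop_mulOp_comp, comp_add, assoc, assoc]
  | deriv P h =>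
    rw [assoc, dop_deriv_comp, h, dop_deriv_comp, comp_add, add_comp, assoc, assoc, assoc]; abel
  | one =>
    have h1 : dop a (mulOp (1 : Jet K ι z)) = 0 := by
      have := dop_mon a 0 (1 : Jet K ι z)
      simpa using this
    rw [h1, dop_mulOp_comp]
    exact diffOp_ext fun f => by simp

theorem dop_comm (a : Jet K ι z) (P Q : DiffOp (Jet K ι z)) :
    dop a (comm P Q) = comm (dop a P) Q + comm P (dop a Q) := by
  rw [comm, map_sub, dop_comp, dop_comp, comm, comm]; abel

/-- Both derivations kill functions and send ∂ to a function, so their commutator kills the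
generators. This is why the φ-directions form an abelian algebra. -/
theorem dop_dop (a b : Jet K ι z) (P : DiffOp (Jet K ι z)) :
    dop a (dop b P) = dop b (dop a P) := by
  induction P using diffOp_induction with
  | add P P' h h' => simp only [map_add, h, h']
  | mul f P h => simp only [dop_mulOp_comp, h]
  | deriv P h => simp only [dop_deriv_comp, dop_mulOp_comp, map_add, h]; abel
  | one =>
    have h1 : ∀ a : Jet K ι z, dop a (mulOp (1 : Jet K ι z)) = 0 := fun a => by
      have := dop_mon a 0 (1 : Jet K ι z)
      simpa using this
    rw [h1, h1, map_zero, map_zero]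

/-- A derivation applied to the coefficients of an operator. -/
def mapOp (D : Derivation ℤ (Jet K ι z) (Jet K ι z)) :
    DiffOp (Jet K ι z) →+ DiffOp (Jet K ι z) :=
  AddMonoidHom.mk' (fun P => P.sum fun n a => mon n (D a))
    fun P Q => Polynomial.sum_add_index _ _ _ (by simp) (by simp)

@[simp] theorem mapOp_mon (D : Derivation ℤ (Jet K ι z) (Jet K ι z)) (n : ℕ) (a : Jet K ι z) :
    mapOp D (mon n a) = mon n (D a) := by
  simp [mapOp, Polynomial.sum_monomial_index]

theorem act_mapOp_evol (V : ι → Jet K ι z) (P : DiffOp (Jet K ι z)) (f : Jet K ι z) :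
    (mapOp (evol V) P).act f = evol V (P.act f) - P.act (evol V f) := by
  induction P using Polynomial.induction_on' with
  | add P Q hP hQ => simp only [map_add, act_add, hP, hQ]; abel
  | monomial n a =>
    have := mapOp_mon (evol V) n a
    rw [this, act_mon, act_mon, act_mon, Derivation.leibniz, evol_iter, smul_eq_mul, smul_eq_mul]
    ring

theorem mapOp_comm (V : ι → Jet K ι z) (P Q : DiffOp (Jet K ι z)) :
    mapOp (evol V) (comm P Q) = comm (mapOp (evol V) P) Q + comm P (mapOp (evol V) Q) :=
  diffOp_ext fun f => by simp [comm, act_mapOp_evol]; abel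

theorem mapOp_dop (V : ι → Jet K ι z) (a : Jet K ι z) (P : DiffOp (Jet K ι z)) :
    mapOp (evol V) (dop a P) = dop (evol V a) P + dop a (mapOp (evol V) P) := by
  induction P using Polynomial.induction_on' with
  | add P Q hP hQ => simp only [map_add, hP, hQ]; abel
  | monomial n c =>
    have h1 := mapOp_mon (evol V) n c
    have h2 := fun a => dop_mon a n c
    rw [h1, h2, h2, dop_mon, map_sum, ← Finset.sum_add_distrib]
    refine Finset.sum_congr rfl fun s _ => ?_
    rw [mapOp_mon, ← map_add]
    congr 1
    simp only [Derivation.leibniz, Derivation.map_natCast, evol_iter, smul_eq_mul]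
    ring

end OperatorAlgebra

/-! ### The bilinear form of the KP matrix and its skewness. -/

section KP

variable {K : Type*} [CommRing K] [Differential K]

/-- A sum with binomial coefficients does not depend on the range if it is large enough. -/
theorem sum_choose_range {R : Type*} [CommRing R] (n N : ℕ) (h : n ≤ N) (F : ℕ → R) :
    ∑ l ∈ Finset.range (N + 1), (n.choose l : R) * F l =
      ∑ l ∈ Finset.range (n + 1), (n.choose l : R) * F l := by
  symm
  refine Finset.sum_subset (Finset.range_mono (by omega)) fun l _ hl => ?_
  rw [Nat.choose_eq_zero_of_lt (by simpa using hl), Nat.cast_zero, zero_mul]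

variable (K) in
/-- The value of the covector `P`, viewed as an operator `∑ Pₙ ∂ⁿ`, on the vector `(Aₙ)`. -/
def evA : DiffOp (KPJet K) →ₗ[KPJet K] KPJet K :=
  Polynomial.lsum fun n => LinearMap.mulRight _ (A n)

theorem evA_mon (n : ℕ) (f : KPJet K) : evA K (mon n f) = f * A n := by
  simp [evA, Polynomial.sum_monomial_index]

variable (K) in
/-- The flux of `A₀`: if `Aₙ` evolves along the covector `P`, then `A₀` has the derivative
`∂ (flux P)`. -/
def flux : DiffOp (KPJet K) →+ KPJet K :=
  AddMonoidHom.mk' (fun P => P.sum fun m c => ∑ s ∈ Finset.range m,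
      (-1) ^ s * iter s ((m.choose (s + 1) : KPJet K) * A (m - 1 - s) * c))
    fun P Q => Polynomial.sum_add_index _ _ _ (by simp)
      (by intros; simp [mul_add, Finset.sum_add_distrib])

theorem flux_mon (m : ℕ) (c : KPJet K) : flux K (mon m c) = ∑ s ∈ Finset.range m,
    (-1) ^ s * iter s ((m.choose (s + 1) : KPJet K) * A (m - 1 - s) * c) := by
  simp [flux, Polynomial.sum_monomial_index]

/-- Integration by parts frees a from its derivatives: `flux P` is the quantity dual to the slope a.
-/
theorem tr_evA_dop (a : KPJet K) (P : DiffOp (KPJet K)) :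
    tr _ (evA K (dop a P)) = tr _ (a * flux K P) := by
  induction P using Polynomial.induction_on' with
  | add P Q hP hQ => rw [map_add, map_add, map_add, hP, hQ, map_add, mul_add, map_add]
  | monomial m c =>
    have h1 := dop_mon a m c
    have h2 := flux_mon m c
    rw [h1, h2, map_sum, map_sum, Finset.mul_sum, map_sum]
    refine Finset.sum_congr rfl fun s _ => ?_
    have h := tr_mul_iter s ((m.choose (s + 1) : KPJet K) * A (m - 1 - s) * c) a
    rw [evA_mon]
    refine Eq.trans (congrArg _ ?_) (h.trans (congrArg _ ?_)) <;> ring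

variable (α : K)

/-- The operator `φₓ + α φ ∂` on functions. -/
def advect (v : KPJet K) : KPJet K := (q .φ 0)′ * v + base α * q .φ 0 * v′

/-- The function `a` such that the pairing of the momentum of `φ` with the velocity is given by
the derivation `∂ ↦ a` of operators. -/
def slope (ξ : KPJet K) : KPJet K := qInv * (base α * (q .φ 0 * ξ)′ - (q .φ 0)′ * ξ)

theorem act_kp_AA (n m : ℕ) (f : KPJet K) : (kpMatrix α (.A n) (.A m)).act f =
    ∑ μ ∈ Finset.range (n + m + 1), ((n.choose μ : KPJet K) * (A (n + m - μ) * iter μ f)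
      - (m.choose μ : KPJet K) * ((-1) ^ μ * iter μ (A (n + m - μ) * f))) := by
  simp only [kpMatrix, act_sum_op, act_sub_op, act_mon, act_comp, act_mulOp]
  refine Finset.sum_congr rfl fun μ _ => ?_
  rw [mul_assoc, mul_assoc, iter_natCast_mul]
  ring

theorem act_kp_φA (m : ℕ) (f : KPJet K) : (kpMatrix α .φ (.A m)).act f =
    advect α (qInv * flux K (mon m f)) := by
  rw [flux_mon]
  simp only [kpMatrix, phiOp, act_comp, act_add, act_sum_op, act_mon, act_mulOp, advect]
  rfl

theorem act_kp_Aφ (n : ℕ) (f : KPJet K) : (kpMatrix α (.A n) .φ).act f =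
    ∑ s ∈ Finset.range n, (n.choose (s + 1) : KPJet K) * A (n - 1 - s) * iter s (slope α f) := by
  simp only [kpMatrix, phiOp', act_comp, act_sub_op, act_sum_op, act_mon, act_mulOp, slope]
  rfl

theorem act_kp_φφ (f : KPJet K) : (kpMatrix α .φ .φ).act f = 0 := by
  simp [kpMatrix]

/-- The Leibniz expansions of the two products in the commutator yield the two binomial sums of the
entry, the second after integration by parts. -/
theorem tr_act_kp_AA (n m : ℕ) (f g : KPJet K) :
    tr _ (g * (kpMatrix α (.A n) (.A m)).act f) = tr _ (evA K (comm (mon n g) (mon m f))) := by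
  have h1 : ∀ (n m : ℕ) (f g : KPJet K), evA K (mon n g ⊙ mon m f) =
      ∑ μ ∈ Finset.range (n + 1), (n.choose μ : KPJet K) * (g * (A (n + m - μ) * iter μ f)) := by
    intro n m f g
    rw [comp_mon, map_sum]
    refine Finset.sum_congr rfl fun l hl => ?_
    rw [evA_mon, show n - l + m = n + m - l by have := Finset.mem_range.mp hl; omega]
    ring
  rw [act_kp_AA, comm, map_sub, h1, h1, ← sum_choose_range n (n + m) (by omega),
    ← sum_choose_range m (n + m) (by omega), ← Finset.sum_sub_distrib, Finset.mul_sum, map_sum,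
    map_sum]
  refine Finset.sum_congr rfl fun μ _ => ?_
  have h2 := tr_mul_iter μ ((m.choose μ : KPJet K) * ((-1) ^ μ * g)) (A (n + m - μ) * f)
  rw [iter_natCast_mul, iter_neg_one_pow_mul] at h2
  rw [mul_sub, map_sub, map_sub, mul_left_comm g, Nat.add_comm m n]
  congr 1
  refine Eq.trans (congrArg _ ?_) (h2.trans (congrArg _ ?_))
  · ring
  · linear_combination ((m.choose μ : KPJet K) * iter μ g * A (n + m - μ) * f) *
      (by rw [← mul_pow]; simp : (-1 : KPJet K) ^ μ * (-1) ^ μ = 1)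

theorem mul_act_kp_Aφ (n : ℕ) (f g : KPJet K) :
    g * (kpMatrix α (.A n) .φ).act f = evA K (dop (slope α f) (mon n g)) := by
  rw [act_kp_Aφ, dop_mon, map_sum, Finset.mul_sum]
  refine Finset.sum_congr rfl fun s _ => ?_
  rw [evA_mon]
  ring

/-- `slope` is minus the adjoint of v ↦ `advect` (v/A₀). The witness is the boundary term from
integrating αφ∂ by parts, where α must be constant. -/
theorem tr_mul_advect (hα : α′ = 0) (ξ v : KPJet K) :
    tr _ (ξ * advect α (qInv * v)) = -tr _ (slope α ξ * v) := by
  rw [← map_neg]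
  refine tr_eq_of_sub (base α * q .φ 0 * ξ * (qInv * v)) ?_
  simp only [advect, slope, Derivation.leibniz, deriv_base, hα, map_zero, smul_eq_mul]
  ring

theorem kp_skew (hα : α′ = 0) : ∀ i j (f g : KPJet K), tr _ (g * (kpMatrix α i j).act f) =
    -tr _ (f * (kpMatrix α j i).act g)
  | .A n, .A m, f, g => by
    rw [tr_act_kp_AA, tr_act_kp_AA, ← map_neg, ← map_neg, comm, comm, neg_sub]
  | .A n, .φ, f, g => by
    rw [mul_act_kp_Aφ, tr_evA_dop, act_kp_φA, tr_mul_advect α hα, neg_neg]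
  | .φ, .A m, f, g => by
    rw [mul_act_kp_Aφ, tr_evA_dop, act_kp_φA, tr_mul_advect α hα]
  | .φ, .φ, f, g => by simp [kpMatrix]

end KP

/-! ### The Jacobi identity for the extended KP matrix. -/

section KPHamiltonian

variable {K : Type*} [CommRing K] [Differential K]

variable (K) in
/-- The components of a covector at the variables `Aₙ` as an operator. -/
def covOp : (KPVar →₀ KPJet K) →+ DiffOp (KPJet K) :=
  Finsupp.liftAddHom fun i => match i with
    | .A n => (Polynomial.monomial n).toAddMonoidHom
    | .φ => 0

@[simp] theorem covOp_single_A (n : ℕ) (f : KPJet K) :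
    covOp K (Finsupp.single (.A n) f) = mon n f := by
  simp [covOp]

@[simp] theorem covOp_single_φ (f : KPJet K) : covOp K (Finsupp.single .φ f) = 0 := by
  simp [covOp]

theorem mapCov_add {ι : Type*} {z : ι} (D : Derivation ℤ (Jet K ι z) (Jet K ι z))
    (X Y : ι →₀ Jet K ι z) : mapCov D (X + Y) = mapCov D X + mapCov D Y := by
  ext; simp

theorem mapCov_single {ι : Type*} {z : ι} (D : Derivation ℤ (Jet K ι z) (Jet K ι z))
    (i : ι) (f : Jet K ι z) : mapCov D (Finsupp.single i f) = Finsupp.single i (D f) :=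
  Finsupp.mapRange_single

theorem covOp_mapCov (D : Derivation ℤ (KPJet K) (KPJet K)) (X : KPVar →₀ KPJet K) :
    covOp K (mapCov D X) = mapOp D (covOp K X) := by
  induction X using Finsupp.induction_linear with
  | zero => simp [mapCov]
  | add X Y h h' => rw [mapCov_add, map_add, map_add, h, h', map_add]
  | single i f =>
    rw [mapCov_single]
    cases i with
    | A n =>
      have := mapOp_mon D n f
      rw [covOp_single_A, covOp_single_A, this]
    | φ => rw [covOp_single_φ, covOp_single_φ, map_zero]

/-- The value of a covector on the vector with the components `V n` at the variables `Aₙ`. -/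
def evVec (V : KPVar → KPJet K) : DiffOp (KPJet K) →ₗ[KPJet K] KPJet K :=
  Polynomial.lsum fun n => LinearMap.mulRight _ (V (.A n))

theorem evVec_mon (V : KPVar → KPJet K) (n : ℕ) (f : KPJet K) :
    evVec V (mon n f) = f * V (.A n) := by
  simp [evVec, Polynomial.sum_monomial_index]

theorem evol_evA (V : KPVar → KPJet K) (P : DiffOp (KPJet K)) :
    evol V (evA K P) = evVec V P + evA K (mapOp (evol V) P) := by
  induction P using Polynomial.induction_on' with
  | add P Q hP hQ => rw [map_add, map_add, hP, hQ, map_add, map_add, map_add]; abel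
  | monomial n f =>
    have h1 := evA_mon n f
    have h2 := evVec_mon V n f
    have h3 := mapOp_mon (evol V) n f
    rw [h1, h2, h3, evA_mon, Derivation.leibniz, A, evol_q]
    simp only [smul_eq_mul, iter_zero]
    ring

variable (α : K)

theorem slope_add (f g : KPJet K) : slope α (f + g) = slope α f + slope α g := by
  simp only [slope, mul_add, map_add]; ring

@[simp] theorem slope_zero : slope α (0 : KPJet K) = 0 := by simp [slope]

/-- The operator representing the linear form `X ↦ S(W, X)` on the components at the `Aₙ`. -/
def kpAd (W : KPVar →₀ KPJet K) (P : DiffOp (KPJet K)) : DiffOp (KPJet K) :=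
  comm P (covOp K W) + dop (slope α (W .φ)) P

/-- The operator `[Y, X]`, extended to covectors with a component at `φ`. -/
def kpOp (X Y : KPVar →₀ KPJet K) : DiffOp (KPJet K) :=
  kpAd α X (covOp K Y) - dop (slope α (Y .φ)) (covOp K X)

/-- The bilinear form of the extended KP matrix modulo divergences. -/
def kpForm (X Y : KPVar →₀ KPJet K) : KPJet K := evA K (kpOp α X Y)

theorem comm_add_left (P P' Q : DiffOp (KPJet K)) : comm (P + P') Q = comm P Q + comm P' Q :=
  diffOp_ext fun f => by simp [comm, act_map_add]; abel

theorem comm_add_right (P Q Q' : DiffOp (KPJet K)) : comm P (Q + Q') = comm P Q + comm P Q' :=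
  diffOp_ext fun f => by simp [comm, act_map_add]; abel

@[simp] theorem comm_zero_left (P : DiffOp (KPJet K)) : comm 0 P = 0 :=
  diffOp_ext fun f => by simp [comm]

@[simp] theorem comm_zero_right (P : DiffOp (KPJet K)) : comm P 0 = 0 :=
  diffOp_ext fun f => by simp [comm]

theorem kpForm_add_left (X X' Y : KPVar →₀ KPJet K) :
    kpForm α (X + X') Y = kpForm α X Y + kpForm α X' Y := by
  simp only [kpForm, kpOp, kpAd, ← map_add]
  congr 1
  simp only [map_add, comm_add_right, Finsupp.add_apply, slope_add, dop_add_left]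
  abel

theorem kpForm_add_right (X Y Y' : KPVar →₀ KPJet K) :
    kpForm α X (Y + Y') = kpForm α X Y + kpForm α X Y' := by
  simp only [kpForm, kpOp, kpAd, ← map_add]
  congr 1
  simp only [map_add, comm_add_left, Finsupp.add_apply, slope_add, dop_add_left]
  abel

theorem tr_kpForm (hα : α′ = 0) (X Y : KPVar →₀ KPJet K) :
    tr _ (kpForm α X Y) = tr _ (pair (app (kpMatrix α) X) Y) := by
  have hAφ : ∀ (n : ℕ) (f : KPJet K), (Finsupp.single (KPVar.A n) f) .φ = 0 := fun n f =>
    Finsupp.single_eq_of_ne (by simp)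
  induction X using Finsupp.induction_linear with
  | zero => simp [kpForm, kpOp, kpAd, pair]
  | add X X' h h' => rw [app_add, pair_add_left, map_add, ← h, ← h', kpForm_add_left, map_add]
  | single j f =>
    induction Y using Finsupp.induction_linear with
    | zero => simp [kpForm, kpOp, kpAd]
    | add Y Y' h h' => rw [pair_add, map_add, ← h, ← h', kpForm_add_right, map_add]
    | single i g =>
      rw [pair_single, app_single]
      cases j with
      | A m =>
        cases i with
        | A n => simp [kpForm, kpOp, kpAd, hAφ, tr_act_kp_AA]
        | φ =>
          rw [act_kp_φA, tr_mul_advect α hα, ← tr_evA_dop]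
          simp [kpForm, kpOp, kpAd]
      | φ =>
        cases i with
        | A n => simp [kpForm, kpOp, kpAd, hAφ, mul_act_kp_Aφ]
        | φ => simp [kpForm, kpOp, kpAd, act_kp_φφ]

/-- The velocity of the Aₙ is a coadjoint action: pairing it with P amounts to evaluating `kpAd α W
P` at the unmoved Aₙ. -/
theorem tr_evVec_app (hα : α′ = 0) (W : KPVar →₀ KPJet K) (P : DiffOp (KPJet K)) :
    tr _ (evVec (app (kpMatrix α) W) P) = tr _ (evA K (kpAd α W P)) := by
  induction P using Polynomial.induction_on' with
  | add P Q hP hQ =>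
    rw [map_add, map_add, hP, hQ, ← map_add, ← map_add]
    simp only [kpAd, comm_add_left, map_add]
    abel
  | monomial n g =>
    have h1 := evVec_mon (app (kpMatrix α) W) n g
    have h2 := tr_kpForm α hα W (Finsupp.single (.A n) g)
    rw [pair_single] at h2
    rw [h1, ← h2, kpForm, kpOp, covOp_single_A, Finsupp.single_eq_of_ne (by simp), slope_zero,
      dop_zero_left, sub_zero]

/-- φ is transported with velocity flux/A₀, where the flux is the one that moves A₀ in
`app_kp_A_zero`. -/
theorem app_kp_φ (W : KPVar →₀ KPJet K) :
    app (kpMatrix α) W .φ = advect α (qInv * flux K (covOp K W)) := by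
  induction W using Finsupp.induction_linear with
  | zero => simp [advect]
  | add X Y h h' =>
    rw [app_add, Pi.add_apply, h, h', map_add, map_add]
    simp only [advect, mul_add, map_add]
    ring
  | single i f =>
    rw [app_single]
    cases i with
    | A m => rw [act_kp_φA, covOp_single_A]
    | φ => rw [act_kp_φφ, covOp_single_φ, map_zero]; simp [advect]

theorem app_kp_A_zero (W : KPVar →₀ KPJet K) :
    app (kpMatrix α) W (.A 0) = (flux K (covOp K W))′ := by
  induction W using Finsupp.induction_linear with
  | zero => simp
  | add X Y h h' => rw [app_add, Pi.add_apply, h, h', map_add, map_add, map_add]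
  | single i f =>
    rw [app_single]
    cases i with
    | A m =>
      -- In row zero the two terms with μ = 0 cancel, and each term with μ = s + 1 of the adjoint
      -- part contains a factor ∂.
      rw [act_kp_AA, covOp_single_A, flux_mon, Finset.sum_range_succ', Nat.zero_add, map_sum]
      simp only [Nat.choose_zero_succ, Nat.choose_zero_right, Nat.sub_zero, pow_zero, iter_zero,
        Nat.cast_one, one_mul, sub_self, add_zero, Nat.cast_zero, zero_mul, zero_sub]
      refine Finset.sum_congr rfl fun s _ => ?_
      rw [← iter_neg_one_pow_mul s s, ← iter_succ, mul_assoc, iter_neg_one_pow_mul,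
        iter_natCast_mul, show m - (s + 1) = m - 1 - s by omega]
      ring
    | φ => simp [act_kp_Aφ]

/-- The change of `slope` along the evolution field of the covector `W`. -/
def slopeVariation (W : KPVar →₀ KPJet K) (η : KPJet K) : KPJet K :=
  evol (app (kpMatrix α) W) (slope α η) - slope α (evol (app (kpMatrix α) W) η)

/-- The form is linear in the Aₙ. Moving them gives the `kpAd` term, the variations of X and Y are
subtracted by definition, and the dependence of `slope` on A₀ and φ gives the last two terms,
rewritten by `tr_evA_dop`. -/
theorem tr_formVariation_kp (hα : α′ = 0) (W X Y : KPVar →₀ KPJet K) :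
    tr _ (formVariation (kpMatrix α) (kpForm α) W X Y) = tr _ (evA K (kpAd α W (kpOp α X Y))) +
      tr _ (slopeVariation α W (X .φ) * flux K (covOp K Y)) -
      tr _ (slopeVariation α W (Y .φ) * flux K (covOp K X)) := by
  rw [← tr_evVec_app α hα, ← tr_evA_dop, ← tr_evA_dop, ← map_add, ← map_sub, add_sub_assoc,
    ← map_sub]
  congr 1
  rw [formVariation, kpForm, evol_evA, add_sub_assoc, add_sub_assoc]
  congr 1
  rw [kpForm, kpForm, ← map_sub, ← map_sub]
  congr 1
  simp only [kpOp, kpAd, slopeVariation, map_add, map_sub, covOp_mapCov, mapOp_comm, mapOp_dop,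
    dop_sub_left, mapCov_apply]
  abel

/-- Jacobi identity of a semidirect product: the commutator satisfies Jacobi, each `dop` is a
derivation of it, and the `dop`s commute. -/
theorem kpAd_kpOp_cyclic (X Y W : KPVar →₀ KPJet K) :
    kpAd α W (kpOp α X Y) + kpAd α X (kpOp α Y W) + kpAd α Y (kpOp α W X) = 0 := by
  have h := comm_jacobi (covOp K Y) (covOp K X) (covOp K W)
  simp only [kpAd, kpOp, map_add, map_sub, dop_comm]
  rw [dop_dop (slope α (X .φ)) (slope α (W .φ)), dop_dop (slope α (Y .φ)) (slope α (W .φ)),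
    dop_dop (slope α (Y .φ)) (slope α (X .φ))]
  refine diffOp_ext fun f => ?_
  have hf := congrArg (fun P : DiffOp (KPJet K) => P.act f) h
  simp only [comm, act_add, act_sub_op, act_comp, act_map_add, act_map_sub, act_zero_op] at hf ⊢
  abel

/-- The left side is the variation of the slope of e, with h and the density p moving along the
velocity v, paired with the flux h u. The claim is its symmetry in the two velocities. -/
theorem tr_transport_symm {R : Type*} [CommRing R] [Differential R] (h i p a e v u : R)
    (ha : a′ = 0) (hi : h * i = 1) :
    tr R ((-(i ^ 2 * (h * v)′) * (a * (p * e)′ - p′ * e) +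
        i * (a * ((p′ * v + a * p * v′) * e)′ - (p′ * v + a * p * v′)′ * e)) * (h * u)) =
      tr R ((-(i ^ 2 * (h * u)′) * (a * (p * e)′ - p′ * e) +
        i * (a * ((p′ * u + a * p * u′) * e)′ - (p′ * u + a * p * u′)′ * e)) * (h * v)) := by
  -- The witness collects the boundary terms from integrating by parts every term of the form a·(…)′
  -- in the antisymmetrized expression.
  refine tr_eq_of_sub (a * (p′ * v + a * p * v′) * e * u - a * (p′ * u + a * p * u′) * e * v
    - a * p * e * (v′ * u - u′ * v)) ?_
  simp only [Derivation.leibniz, map_add, map_sub, ha, smul_eq_mul]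
  -- The factor i h + 1 comes from (i h)² - 1, as the variation of 1/h carries i² and the flux
  -- supplies a second h.
  linear_combination (-(i * h + 1) * (v′ * u - u′ * v) * (a * (p * e′ + e * p′) - p′ * e) +
    (a * ((p′′ * v + p′ * v′ + a * (p′ * v′ + p * v′′)) * e + (p′ * v + a * p * v′) * e′) -
      (p′′ * v + p′ * v′ + a * (p′ * v′ + p * v′′)) * e) * u -
    (a * ((p′′ * u + p′ * u′ + a * (p′ * u′ + p * u′′)) * e + (p′ * u + a * p * u′) * e′) -
      (p′′ * u + p′ * u′ + a * (p′ * u′ + p * u′′)) * e) * v) * hi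

theorem flux_eq (P : DiffOp (KPJet K)) : flux K P = A 0 * (qInv * flux K P) := by
  rw [← mul_assoc]
  have : (A 0 : KPJet K) * qInv = 1 := q_mul_qInv
  rw [this, one_mul]

theorem slopeVariation_eq (W : KPVar →₀ KPJet K) (η : KPJet K) :
    slopeVariation α W η = -(qInv ^ 2 * (flux K (covOp K W))′) *
        (base α * (q .φ 0 * η)′ - (q .φ 0)′ * η) +
      qInv * (base α * (advect α (qInv * flux K (covOp K W)) * η)′ -
        (advect α (qInv * flux K (covOp K W)))′ * η) := by
  have h1 : evol (app (kpMatrix α) W) (qInv : KPJet K) =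
      -(qInv ^ 2 * (flux K (covOp K W))′) := by
    have h := congrArg (evol (app (kpMatrix α) W)) (q_mul_qInv (K := K) (z := KPVar.A 0))
    rw [Derivation.leibniz, Derivation.map_one_eq_zero, evol_q, iter_zero, app_kp_A_zero] at h
    simp only [smul_eq_mul] at h
    linear_combination qInv * h -
      evol (app (kpMatrix α) W) (qInv : KPJet K) * (q_mul_qInv (K := K) (z := KPVar.A 0))
  simp only [slopeVariation, slope, Derivation.leibniz, map_sub, evol_deriv, h1, smul_eq_mul,
    evol_base, evol_q, iter_zero, app_kp_φ, map_add]
  ring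

theorem tr_slopeVariation_symm (hα : α′ = 0) (W X : KPVar →₀ KPJet K) (η : KPJet K) :
    tr _ (slopeVariation α W η * flux K (covOp K X)) =
      tr _ (slopeVariation α X η * flux K (covOp K W)) := by
  have h := tr_transport_symm (A 0) qInv (q .φ 0) (base α : KPJet K) η
    (qInv * flux K (covOp K W)) (qInv * flux K (covOp K X)) (by simp [hα]) q_mul_qInv
  rw [← flux_eq, ← flux_eq] at h
  rw [slopeVariation_eq, slopeVariation_eq]
  exact h

theorem isHamiltonian_kpMatrix [Algebra ℚ K] (hα : α′ = 0) : IsHamiltonian (kpMatrix α) := by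
  refine IsHamiltonian.of_form (S := kpForm α) (kp_skew α hα) (tr_kpForm α hα) fun X Y W => ?_
  -- The symmetry makes the six slope terms cancel in pairs; the cyclic identity disposes of the
  -- others.
  rw [tr_formVariation_kp α hα, tr_formVariation_kp α hα, tr_formVariation_kp α hα,
    tr_slopeVariation_symm α hα W Y, tr_slopeVariation_symm α hα W X,
    tr_slopeVariation_symm α hα X Y]
  have h := congrArg (fun P => tr _ (evA K P)) (kpAd_kpOp_cyclic α X Y W)
  simp only [map_add, map_zero] at h
  rw [← h]
  abel

end KPHamiltonian

/-! ### Differential substitutions in operators. -/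

section Substitution

variable {K : Type*} [CommRing K] [Differential K] {ι κ : Type*} {z : ι} {w : κ}

theorem subst_base (Ψ : ι → Jet K κ w) (hΨ : IsUnit (Ψ z)) (a : K) :
    subst Ψ hΨ (base a) = base a :=
  Jet.lift_base _ _ _ a

theorem subst_q (Ψ : ι → Jet K κ w) (hΨ : IsUnit (Ψ z)) (i : ι) (k : ℕ) :
    subst Ψ hΨ (q i k) = iter k (Ψ i) :=
  Jet.lift_q _ _ _ i k

theorem subst_deriv (Ψ : ι → Jet K κ w) (hΨ : IsUnit (Ψ z)) (F : Jet K ι z) :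
    subst Ψ hΨ F′ = (subst Ψ hΨ F)′ := by
  -- ∂ before and ∂ after the substitution are both derivations along it. As homomorphisms to the
  -- dual numbers they need only agree on generators.
  let f : Jet K ι z →+* DualNumber (Jet K κ w) :=
    { toFun := fun F => TrivSqZeroExt.inl (subst Ψ hΨ F) + TrivSqZeroExt.inr (subst Ψ hΨ F′)
      map_one' := by ext <;> simp
      map_zero' := by ext <;> simp
      map_add' := fun a b => by ext <;> simp
      map_mul' := fun a b => by ext <;> simp [mul_comm] }
  let g : Jet K ι z →+* DualNumber (Jet K κ w) :=
    { toFun := fun F => TrivSqZeroExt.inl (subst Ψ hΨ F) + TrivSqZeroExt.inr (subst Ψ hΨ F)′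
      map_one' := by ext <;> simp
      map_zero' := by ext <;> simp
      map_add' := fun a b => by ext <;> simp
      map_mul' := fun a b => by ext <;> simp [mul_comm] }
  have h : f = g := Jet.hom_ext (fun a => by simp [f, g, subst_base])
    (fun i k => by simp [f, g, subst_q, iter_succ])
  simpa [f, g] using congrArg (fun φ : Jet K ι z →+* DualNumber (Jet K κ w) => (φ F).snd) h

theorem subst_iter (Ψ : ι → Jet K κ w) (hΨ : IsUnit (Ψ z)) (k : ℕ) (F : Jet K ι z) :
    subst Ψ hΨ (iter k F) = iter k (subst Ψ hΨ F) := by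
  induction k with
  | zero => rfl
  | succ k ih => rw [iter_succ, subst_deriv, ih, iter_succ]

theorem map_comp (Ψ : ι → Jet K κ w) (hΨ : IsUnit (Ψ z)) (P Q : DiffOp (Jet K ι z)) :
    (P ⊙ Q).map (subst Ψ hΨ) = P.map (subst Ψ hΨ) ⊙ Q.map (subst Ψ hΨ) := by
  induction P using Polynomial.induction_on' with
  | add P P' h h' => rw [add_comp, Polynomial.map_add, h, h', Polynomial.map_add, add_comp]
  | monomial i a =>
    induction Q using Polynomial.induction_on' with
    | add Q Q' h h' => rw [comp_add, Polynomial.map_add, h, h', Polynomial.map_add, comp_add]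
    | monomial j b =>
      rw [comp_mon, Polynomial.map_monomial, Polynomial.map_monomial, comp_mon, Polynomial.map_sum]
      simp [subst_iter]

theorem map_mon (f : Jet K ι z →+* Jet K κ w) (k : ℕ) (a : Jet K ι z) :
    (mon k a).map f = mon k (f a) := Polynomial.map_monomial _

theorem map_mulOp (f : Jet K ι z →+* Jet K κ w) (a : Jet K ι z) :
    (mulOp a).map f = mulOp (f a) := Polynomial.map_C _

/-- An operator is determined by its action on derivatives. -/
theorem diffOp_ext_deriv {P Q : DiffOp (Jet K ι z)} (h : ∀ f, P.act f′ = Q.act f′) : P = Q := by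
  -- Right composition with ∂ creates no Leibniz terms, so it is polynomial multiplication by X,
  -- which is cancellable.
  have hX : ∀ (P : DiffOp (Jet K ι z)) f, DiffOp.act (P * Polynomial.X) f = P.act f′ := by
    intro P f
    induction P using Polynomial.induction_on' with
    | add P Q hP hQ => rw [add_mul, act_add, act_add, hP, hQ]
    | monomial n a => rw [Polynomial.monomial_mul_X, act_mon, act_mon, iter_succ']
  exact (Polynomial.isRegular_X).right (diffOp_ext fun f => by
    change DiffOp.act (P * Polynomial.X) f = DiffOp.act (Q * Polynomial.X) f
    rw [hX, hX, h])

@[simp] theorem zero_comp (P : DiffOp (Jet K ι z)) : (0 : DiffOp (Jet K ι z)) ⊙ P = 0 :=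
  diffOp_ext fun f => by simp

@[simp] theorem comp_zero (P : DiffOp (Jet K ι z)) : P ⊙ (0 : DiffOp (Jet K ι z)) = 0 :=
  diffOp_ext fun f => by simp

@[simp] theorem adj_zero : (0 : DiffOp (Jet K ι z)).adj = 0 := by
  simp [DiffOp.adj]

@[simp] theorem adj_mulOp (a : Jet K ι z) : (mulOp a).adj = mulOp a :=
  diffOp_ext fun f => by
    rw [act_adj, Polynomial.sum_C_index] <;> simp

end Substitution

/-! ### Reduction to the long wave matrix. -/

section Reduction

variable {K : Type*} [CommRing K] [Differential K]

variable (K) in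
/-- The map `f ↦ (∂ + u) f`. -/
def dressed : LWJet K →+ LWJet K :=
  AddMonoidHom.mk' (fun f => f′ + q .u 0 * f) fun f g => by rw [map_add]; ring

theorem dressed_apply (f : LWJet K) : dressed K f = f′ + q .u 0 * f := rfl

theorem Q_eq (n : ℕ) : (Q n : LWJet K) = (dressed K)^[n] 1 := rfl

theorem Q_succ (n : ℕ) : (Q (n + 1) : LWJet K) = dressed K (Q n) :=
  Function.iterate_succ_apply' _ _ _

theorem dressed_iterate_Q_mul (n m : ℕ) (f : LWJet K) : (dressed K)^[n] (Q m * f) =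
    ∑ l ∈ Finset.range (n + 1), (n.choose l : LWJet K) * (Q (n + m - l) * iter l f) := by
  rw [iterate_twisted_leibniz (dressed K) (dressed K)
    (Differential.deriv (R := LWJet K)).toLinearMap.toAddMonoidHom
    (fun a b => by simp [dressed_apply]; ring)]
  refine Finset.sum_congr rfl fun l hl => ?_
  rw [show n + m - l = n - l + m by have := Finset.mem_range.mp hl; omega, Q_eq m, ← Function.iterate_add_apply]
  rfl

theorem evol_single_Q_of_ne {a : LWVar} (ha : a ≠ .u) (f : LWJet K) (n : ℕ) :
    evol (Pi.single a f) (Q n : LWJet K) = 0 := by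
  induction n with
  | zero => simp [Q]
  | succ n ih => simp [Q_succ, dressed_apply, evol_deriv, ih, ha.symm]

/-- For δu = g′ the operator D = ∂ + u changes by [D, g], hence δ(Dⁿ) = [Dⁿ, g]; this is applied to
1. -/
theorem evol_single_deriv_Q (g : LWJet K) (n : ℕ) :
    evol (Pi.single .u g′) (Q n : LWJet K) = (dressed K)^[n] g - g * Q n := by
  induction n with
  | zero => simp [Q]
  | succ n ih =>
    rw [Q_succ, dressed_apply, map_add, evol_deriv, ih, Derivation.leibniz, ih, evol_q,
      Function.iterate_succ_apply']
    simp [dressed_apply]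
    ring

theorem frechet_A_u (n : ℕ) : frechet (kpToLW (.A n) : LWJet K) .u =
    ∑ s ∈ Finset.range n, mon s ((n.choose (s + 1) : LWJet K) * (q .h 0 * Q (n - 1 - s))) := by
  -- The closed formula for δQₙ covers only directions δu = g′, which suffice. The term of order
  -- zero in the expansion of Dⁿ(g) cancels against g Qₙ.
  refine diffOp_ext_deriv fun g => ?_
  rw [act_frechet, kpToLW, Derivation.leibniz, evol_single_deriv_Q, evol_q]
  have h := dressed_iterate_Q_mul n 0 g
  have hQ0 : (Q 0 : LWJet K) = 1 := rfl
  rw [hQ0, one_mul, Finset.sum_range_succ'] at h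
  rw [h]
  simp only [Nat.choose_zero_right, Nat.cast_one, one_mul, Nat.sub_zero, Nat.add_zero, iter_zero,
    act_sum_op, act_mon, smul_eq_mul]
  rw [Pi.single_eq_of_ne (by simp), mul_zero, add_zero, mul_comm g, add_sub_cancel_right,
    Finset.mul_sum]
  refine Finset.sum_congr rfl fun s _ => ?_
  rw [iter_succ', show n - (s + 1) = n - 1 - s by omega]
  ring

theorem act_frechet_A_deriv (n : ℕ) (g : LWJet K) :
    (frechet (kpToLW (.A n) : LWJet K) .u).act g′ =
      q .h 0 * ((dressed K)^[n] g - g * Q n) := by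
  rw [act_frechet, kpToLW, Derivation.leibniz, evol_single_deriv_Q, evol_q]
  simp

theorem frechet_A_h (n : ℕ) : frechet (kpToLW (.A n) : LWJet K) .h = mulOp (Q n) :=
  diffOp_ext fun f => by
    rw [act_frechet, kpToLW, Derivation.leibniz, evol_single_Q_of_ne (by simp)]
    simp

theorem frechet_A_φ (n : ℕ) : frechet (kpToLW (.A n) : LWJet K) .φ = 0 :=
  diffOp_ext fun f => by
    rw [act_frechet, kpToLW, Derivation.leibniz, evol_single_Q_of_ne (by simp)]
    simp

theorem frechet_φ_u : frechet (kpToLW .φ : LWJet K) .u = 0 :=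
  diffOp_ext fun f => by rw [act_frechet, kpToLW]; simp

theorem frechet_φ_h : frechet (kpToLW .φ : LWJet K) .h = 0 :=
  diffOp_ext fun f => by rw [act_frechet, kpToLW]; simp

theorem frechet_φ_φ : frechet (kpToLW .φ : LWJet K) .φ = mulOp 1 :=
  diffOp_ext fun f => by rw [act_frechet, kpToLW, act_mulOp]; simp

theorem sum_LWVar {M : Type*} [AddCommMonoid M] (f : LWVar → M) :
    ∑ a, f a = f .u + f .h + f .φ := by
  have : (Finset.univ : Finset LWVar) = {LWVar.u, LWVar.h, LWVar.φ} := rfl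
  rw [this, Finset.sum_insert (by simp), Finset.sum_pair (by simp), add_assoc]

/-- The substitution `Aₙ = h Qₙ(u)`, `φ = φ`. -/
abbrev kpSubst : KPJet K →+* LWJet K := subst kpToLW isUnit_kpToLW

theorem kpSubst_A (n : ℕ) : kpSubst (A n : KPJet K) = q .h 0 * Q n := by
  rw [A, kpSubst, subst_q]; rfl

theorem kpSubst_φ (k : ℕ) : kpSubst (q .φ k : KPJet K) = q .φ k := by
  rw [kpSubst, subst_q, kpToLW, iter_q, zero_add]

theorem kpSubst_qInv : kpSubst (qInv : KPJet K) = qInv := by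
  have h := congrArg kpSubst (q_mul_qInv (K := K) (z := KPVar.A 0))
  rw [map_mul, map_one] at h
  have h2 := kpSubst_A (K := K) 0
  have hQ0 : (Q 0 : LWJet K) = 1 := rfl
  rw [A, hQ0, mul_one] at h2
  rw [h2] at h
  linear_combination qInv * h - kpSubst (qInv : KPJet K) * q_mul_qInv (K := K) (z := LWVar.h)

theorem map_phiOp (α : K) : (phiOp (base α) (q .φ 0 : KPJet K)).map kpSubst =
    phiOp (base α) (q .φ 0) := by
  simp only [phiOp, Polynomial.map_add, map_mon, map_mulOp, deriv_q, kpSubst_φ, map_mul,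
    kpSubst, subst_base]

theorem map_phiOp' (α : K) : (phiOp' (base α) (q .φ 0 : KPJet K)).map kpSubst =
    phiOp' (base α) (q .φ 0) := by
  simp only [phiOp', Polynomial.map_sub, map_comp, map_mon, map_mulOp, deriv_q, kpSubst_φ,
    kpSubst, subst_base]

theorem map_negDPow (k : ℕ) : (negDPow (KPJet K) k).map kpSubst = negDPow (LWJet K) k := by
  simp [negDPow]

variable (α : K)

theorem act_map_kp_AA (n m : ℕ) (f : LWJet K) : DiffOp.act ((kpMatrix α (.A n) (.A m)).map kpSubst) f =
    ∑ μ ∈ Finset.range (n + m + 1),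
      ((n.choose μ : LWJet K) * (q .h 0 * Q (n + m - μ) * iter μ f)
        - (m.choose μ : LWJet K) * ((-1) ^ μ * iter μ (q .h 0 * Q (n + m - μ) * f))) := by
  simp only [kpMatrix, Polynomial.map_sum, Polynomial.map_sub, map_comp, map_mon,
    map_mulOp, act_sum_op, act_sub_op, act_mon, act_comp, act_mulOp]
  simp only [map_mul, map_natCast, map_pow, map_neg, map_one, kpSubst_A]
  refine Finset.sum_congr rfl fun μ _ => ?_
  rw [mul_assoc, mul_assoc (m.choose μ : LWJet K), iter_natCast_mul]
  ring

theorem tr_act_map_kp_AA (n m : ℕ) (f g : LWJet K) :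
    tr _ (g * DiffOp.act ((kpMatrix α (.A n) (.A m)).map kpSubst) f) =
      tr _ (q .h 0 * (g * (dressed K)^[n] (Q m * f) - f * (dressed K)^[m] (Q n * g))) := by
  rw [act_map_kp_AA, dressed_iterate_Q_mul, dressed_iterate_Q_mul,
    ← sum_choose_range n (n + m) (by omega), ← sum_choose_range m (n + m) (by omega),
    Finset.mul_sum, Finset.mul_sum, Finset.mul_sum, ← Finset.sum_sub_distrib, Finset.mul_sum,
    map_sum, map_sum]
  refine Finset.sum_congr rfl fun μ _ => ?_
  have h := tr_mul_iter μ ((m.choose μ : LWJet K) * ((-1) ^ μ * g)) (q .h 0 * Q (n + m - μ) * f)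
  rw [iter_natCast_mul, iter_neg_one_pow_mul] at h
  rw [mul_sub, mul_sub, map_sub, map_sub, Nat.add_comm m n]
  congr 1
  · congr 1
    ring
  · refine Eq.trans (congrArg _ ?_) (h.trans (congrArg _ ?_))
    · ring
    · linear_combination
        ((m.choose μ : LWJet K) * iter μ g * (q .h 0 * Q (n + m - μ) * f)) *
        (by rw [← mul_pow]; simp : (-1 : LWJet K) ^ μ * (-1) ^ μ = 1)

/-- Since ∂ stands next to the Fréchet derivative in u, that derivative meets only directions g′,
where `act_frechet_A_deriv` applies. The two products h Qₙ Qₘ f g then cancel, leaving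
`tr_act_map_kp_AA`. -/
theorem kp_reduces_AA [Algebra ℚ K] (n m : ℕ) : (kpMatrix α (.A n) (.A m)).map kpSubst =
    frechet (kpToLW (.A n) : LWJet K) .u ⊙ mon 1 1 ⊙ mulOp (Q m) +
      mulOp (Q n) ⊙ mon 1 1 ⊙ (frechet (kpToLW (.A m) : LWJet K) .u).adj := by
  refine diffOp_ext_tr fun f g => ?_
  rw [tr_act_map_kp_AA]
  simp only [act_add, act_comp, act_mulOp, act_mon, one_mul]
  have h1 : ∀ f : LWJet K, iter 1 f = f′ := fun f => rfl
  have h2 : tr _ ((g * Q n)′ * (frechet (kpToLW (.A m) : LWJet K) .u).adj.act f) =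
      tr _ (f * (frechet (kpToLW (.A m) : LWJet K) .u).act (g * Q n)′) := (tr_act_adj _ _ _).symm
  rw [h1, h1, act_frechet_A_deriv, mul_add, map_add, ← mul_assoc g (Q n), tr_mul_deriv, h2,
    act_frechet_A_deriv, ← map_neg, ← map_add, mul_comm (Q n) g]
  congr 1
  ring

theorem kp_reduces_Aφ (n : ℕ) : (kpMatrix α (.A n) .φ).map kpSubst =
    frechet (kpToLW (.A n) : LWJet K) .u ⊙ lwMatrix α .u .φ ⊙ mulOp 1 := by
  refine diffOp_ext fun f => ?_
  rw [frechet_A_u]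
  simp only [kpMatrix, Polynomial.map_sum, map_comp, map_phiOp', map_mon, map_mulOp]
  simp only [act_sum_op, act_comp, act_mon, act_mulOp, phiOp', lwMatrix, act_sub_op, act_add,
    act_neg_op]
  simp only [map_mul, map_natCast, kpSubst_A, kpSubst_qInv]
  refine Finset.sum_congr rfl fun s _ => ?_
  congr 2
  simp only [iter_succ, iter_zero, one_mul]
  ring

theorem kp_reduces_φA [Algebra ℚ K] (m : ℕ) : (kpMatrix α .φ (.A m)).map kpSubst =
    mulOp 1 ⊙ lwMatrix α .φ .u ⊙ (frechet (kpToLW (.A m) : LWJet K) .u).adj := by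
  have h : (frechet (kpToLW (.A m) : LWJet K) .u).adj = ∑ s ∈ Finset.range m,
      negDPow (LWJet K) s ⊙ mulOp ((m.choose (s + 1) : LWJet K) * (q .h 0 * Q (m - 1 - s))) := by
    refine adj_eq_of_tr fun f g => ?_
    rw [frechet_A_u]
    simp only [act_sum_op, act_mon, act_comp, act_mulOp, Finset.mul_sum, map_sum]
    refine Finset.sum_congr rfl fun s _ => ?_
    rw [← mul_assoc, tr_mul_iter]
    congr 1
    rw [mul_comm g]
    ring
  refine diffOp_ext fun f => ?_
  rw [h]
  simp only [kpMatrix, Polynomial.map_sum, map_comp, map_phiOp, map_negDPow, map_mulOp]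
  simp only [act_comp, act_mon, act_mulOp, phiOp, lwMatrix, act_add, one_mul, iter_succ, iter_zero,
    act_sum_op]
  simp only [map_mul, map_natCast, kpSubst_A, kpSubst_qInv]
  ring

theorem kp_reduces [Algebra ℚ K] :
    ReducesTo (K := K) kpToLW isUnit_kpToLW (kpMatrix α) (lwMatrix α) := by
  intro i j
  simp only [sum_LWVar]
  cases i with
  | A n =>
    cases j with
    | A m =>
      refine (kp_reduces_AA α n m).trans ?_
      simp [frechet_A_h, frechet_A_φ, lwMatrix]
    | φ =>
      refine (kp_reduces_Aφ α n).trans ?_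
      simp only [frechet_A_h, frechet_A_φ, frechet_φ_u, frechet_φ_h, frechet_φ_φ, adj_mulOp]
      simp [lwMatrix]
  | φ =>
    cases j with
    | A m =>
      refine (kp_reduces_φA α m).trans ?_
      simp only [frechet_A_h, frechet_A_φ, frechet_φ_u, frechet_φ_h, frechet_φ_φ, adj_mulOp]
      simp [lwMatrix]
    | φ =>
      simp only [frechet_φ_u, frechet_φ_h, frechet_φ_φ, adj_mulOp]
      simp [lwMatrix, kpMatrix]

end Reduction

/-! ### Weights of functions and operators under ∂ ↦ ε∂. -/

section Scaling

variable {K : Type*} [CommRing K] [Differential K] {ι : Type*} {z : ι}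

@[simp] theorem act_one (f : Jet K ι z) : DiffOp.act (1 : DiffOp (Jet K ι z)) f = f := by
  rw [← Polynomial.C_1]
  exact (act_mulOp 1 f).trans (one_mul f)

theorem scale_base (a : K) : scale (base a : Jet K ι z) = Polynomial.C (base a) :=
  Jet.lift_base _ _ _ a

theorem scale_q (i : ι) (k : ℕ) : scale (q i k : Jet K ι z) = Polynomial.monomial k (q i k) :=
  Jet.lift_q _ _ _ i k

/-- The derivatives of `f` of order at most `N` are homogeneous, those of `f` itself having
weight `d`. -/
def HomogUpTo (N d : ℕ) (f : Jet K ι z) : Prop :=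
  ∀ l ≤ N, scale (iter l f) = Polynomial.monomial (d + l) (iter l f)

theorem HomogUpTo.mul {N d e : ℕ} {f g : Jet K ι z} (hf : HomogUpTo N d f)
    (hg : HomogUpTo N e g) : HomogUpTo N (d + e) (f * g) := by
  intro l hl
  rw [iter_mul, map_sum, map_sum]
  refine Finset.sum_congr rfl fun r hr => ?_
  have hr := Finset.mem_range.mp hr
  rw [map_mul, map_mul, map_natCast, hf _ (by omega), hg _ (by omega),
    Polynomial.monomial_mul_monomial, show d + (l - r) + (e + r) = d + e + l by omega,
    ← nsmul_eq_mul, ← nsmul_eq_mul, map_nsmul]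

theorem HomogUpTo.neg {N d : ℕ} {f : Jet K ι z} (hf : HomogUpTo N d f) : HomogUpTo N d (-f) :=
  fun l hl => by rw [iter_neg, map_neg, map_neg, hf l hl]

/-- All derivatives of `f` are homogeneous, `f` itself having weight `d`. -/
def Homog (d : ℕ) (f : Jet K ι z) : Prop := ∀ N, HomogUpTo N d f

theorem Homog.mul {d e : ℕ} {f g : Jet K ι z} (hf : Homog d f) (hg : Homog e g) :
    Homog (d + e) (f * g) := fun N => (hf N).mul (hg N)

theorem homog_natCast (n : ℕ) : Homog 0 (n : Jet K ι z) := fun N l _ => by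
  cases l with
  | zero => rw [iter_zero, map_natCast, add_zero, Polynomial.monomial_zero_left, map_natCast]
  | succ l => simp [iter_succ']

theorem Homog.neg {d : ℕ} {f : Jet K ι z} (hf : Homog d f) : Homog d (-f) := fun N => (hf N).neg

theorem Homog.natCast_mul {d : ℕ} {f : Jet K ι z} (hf : Homog d f) (n : ℕ) :
    Homog d ((n : Jet K ι z) * f) := by
  simpa using (homog_natCast n).mul hf

theorem homog_q (i : ι) (k : ℕ) : Homog k (q i k : Jet K ι z) := fun N l _ => by
  rw [iter_q, scale_q]

/-- `scale` fixes the ground ring, while each derivative should raise the weight by one; for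
constants the higher derivatives vanish and no conflict arises. -/
theorem homog_base {a : K} (ha : a′ = 0) : Homog 0 (base a : Jet K ι z) := fun N l _ => by
  cases l with
  | zero => rw [iter_zero, scale_base]; rfl
  | succ l => simp [iter_succ', ha]

theorem Homog.iter {d : ℕ} {f : Jet K ι z} (hf : Homog d f) (k : ℕ) : Homog (d + k) (iter k f) :=
  fun N l _ => by
    rw [← iter_add_apply, hf (l + k) _ le_rfl, add_assoc, add_comm k l]

theorem scale_qInv : scale (qInv : Jet K ι z) = Polynomial.C qInv := by
  have h := congrArg scale (q_mul_qInv (K := K) (z := z))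
  rw [map_mul, map_one, scale_q, Polynomial.monomial_zero_left] at h
  have h2 := congrArg Polynomial.C (q_mul_qInv (K := K) (z := z))
  rw [Polynomial.C_mul, map_one] at h2
  linear_combination Polynomial.C qInv * h - scale (qInv : Jet K ι z) * h2

theorem homog_qInv : Homog 0 (qInv : Jet K ι z) := by
  intro N
  induction N with
  | zero =>
    intro l hl
    obtain rfl : l = 0 := by omega
    rw [iter_zero, scale_qInv]
    rfl
  | succ N ih =>
    -- The derivative of the inverse involves the inverse undifferentiated, so homogeneity up to
    -- order N yields order N + 1. This induction is the reason for the bound in `HomogUpTo`.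
    have h : (qInv : Jet K ι z)′ = -(qInv * qInv * q z 1) := by
      have h := congrArg (fun f : Jet K ι z => f′) (q_mul_qInv (K := K) (z := z))
      simp only [Derivation.leibniz, Derivation.map_one_eq_zero, deriv_q, smul_eq_mul] at h
      linear_combination qInv * h - (qInv : Jet K ι z)′ * q_mul_qInv (K := K) (z := z)
    have h' : HomogUpTo N 1 (qInv : Jet K ι z)′ := by
      rw [h]
      simpa using ((ih.mul ih).mul (homog_q z 1 N)).neg
    intro l hl
    cases l with
    | zero => exact ih 0 (by omega)
    | succ l => rw [iter_succ', h' l (by omega), zero_add, add_comm]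

/-- Operators that are homogeneous of weight `d`, where `∂` has weight one. -/
def homogOps (K : Type*) [CommRing K] [Differential K] (ι : Type*) (z : ι) (d : ℕ) :
    AddSubgroup (DiffOp (Jet K ι z)) :=
  AddSubgroup.closure {P | ∃ k e c, k + e = d ∧ Homog e c ∧ P = mon k c}

theorem mon_mem_homogOps {k e d : ℕ} {c : Jet K ι z} (h : Homog e c) (hd : k + e = d) :
    mon k c ∈ homogOps K ι z d :=
  AddSubgroup.subset_closure ⟨k, e, c, hd, h, rfl⟩

theorem mulOp_mem_homogOps {e : ℕ} {c : Jet K ι z} (h : Homog e c) :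
    mulOp c ∈ homogOps K ι z e := by
  exact mon_mem_homogOps (k := 0) h (zero_add e)

theorem negDPow_mem_homogOps (k : ℕ) : negDPow (Jet K ι z) k ∈ homogOps K ι z k := by
  refine mon_mem_homogOps (e := 0) ?_ (add_zero k)
  have h1 : Homog 0 (1 : Jet K ι z) := by simpa using homog_natCast (K := K) (z := z) 1
  rcases neg_one_pow_eq_or (Jet K ι z) k with h | h <;> rw [h]
  · exact h1
  · exact h1.neg

theorem comp_mem_homogOps {d e n : ℕ} {P Q : DiffOp (Jet K ι z)} (hP : P ∈ homogOps K ι z d)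
    (hQ : Q ∈ homogOps K ι z e) (hn : d + e = n) : P ⊙ Q ∈ homogOps K ι z n := by
  subst hn
  have neg_comp : ∀ P Q : DiffOp (Jet K ι z), (-P) ⊙ Q = -(P ⊙ Q) := fun P Q =>
    diffOp_ext fun f => by simp
  have comp_neg : ∀ P Q : DiffOp (Jet K ι z), P ⊙ (-Q) = -(P ⊙ Q) := fun P Q =>
    diffOp_ext fun f => by simp
  induction hP using AddSubgroup.closure_induction with
  | zero => rw [zero_comp]; exact zero_mem _
  | add P P' _ _ h h' => rw [add_comp]; exact add_mem h h'
  | neg P _ h => rw [neg_comp]; exact neg_mem h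
  | mem P hP =>
    obtain ⟨i, d', a, rfl, ha, rfl⟩ := hP
    induction hQ using AddSubgroup.closure_induction with
    | zero => rw [comp_zero]; exact zero_mem _
    | add Q Q' _ _ h h' => rw [comp_add]; exact add_mem h h'
    | neg Q _ h => rw [comp_neg]; exact neg_mem h
    | mem Q hQ =>
      obtain ⟨j, e', b, rfl, hb, rfl⟩ := hQ
      rw [comp_mon]
      refine sum_mem fun l hl => ?_
      have hl := Finset.mem_range.mp hl
      exact mon_mem_homogOps ((ha.mul (hb.iter l)).natCast_mul _) (by omega)

theorem scale_coeff_of_mem_homogOps {d : ℕ} {P : DiffOp (Jet K ι z)} (hP : P ∈ homogOps K ι z d)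
    (k : ℕ) : scale (P.coeff k) * Polynomial.X ^ k =
      Polynomial.X ^ d * Polynomial.C (P.coeff k) := by
  induction hP using AddSubgroup.closure_induction with
  | zero => simp
  | add P Q _ _ h h' =>
    rw [Polynomial.coeff_add, map_add, add_mul, h, h', Polynomial.C_add, mul_add]
  | neg P _ h => rw [Polynomial.coeff_neg, map_neg, neg_mul, h, Polynomial.C_neg, mul_neg]
  | mem P hP =>
    obtain ⟨j, e, c, rfl, hc, rfl⟩ := hP
    rw [Polynomial.coeff_monomial]
    split_ifs with h
    · subst h
      have h0 := hc 0 0 le_rfl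
      rw [iter_zero, add_zero] at h0
      rw [h0, ← Polynomial.C_mul_X_pow_eq_monomial]
      ring
    · simp

/-- If the difference of an operator and a homogeneous operator of weight one is a sum of
homogeneous operators of higher weights, the latter is the quasiclassical limit of the former. -/
theorem quasiclassical_of_sum {P P₀ : DiffOp (Jet K ι z)} (h₀ : P₀ ∈ homogOps K ι z 1) (n : ℕ)
    (T : ℕ → DiffOp (Jet K ι z)) (hT : ∀ s, T s ∈ homogOps K ι z (s + 2))
    (h : P = P₀ + ∑ s ∈ Finset.range n, T s) (k : ℕ) :
    ∃ r : Polynomial (Jet K ι z), scale (P.coeff k) * Polynomial.X ^ k =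
      Polynomial.X * Polynomial.C (P₀.coeff k) + Polynomial.X ^ 2 * r := by
  refine ⟨∑ s ∈ Finset.range n, Polynomial.X ^ s * Polynomial.C ((T s).coeff k), ?_⟩
  rw [h, Polynomial.coeff_add, Polynomial.finsetSum_coeff, map_add, add_mul,
    scale_coeff_of_mem_homogOps h₀, pow_one, map_sum, Finset.sum_mul, Finset.mul_sum]
  congr 1
  refine Finset.sum_congr rfl fun s _ => ?_
  rw [scale_coeff_of_mem_homogOps (hT s)]
  ring

end Scaling

/-! ### The quasiclassical limit of the KP matrix. -/

section Limit

variable {K : Type*} [CommRing K] [Differential K]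

theorem homog_A (n : ℕ) : Homog 0 (A n : KPJet K) := homog_q _ 0

variable {α : K}

theorem phiOp_mem_homogOps (hα : α′ = 0) :
    phiOp (base α) (q .φ 0 : KPJet K) ∈ homogOps K KPVar (.A 0) 1 := by
  have h1 : Homog 1 (q .φ 0 : KPJet K)′ := (homog_q _ 0).iter 1
  have h2 : Homog 0 (base α * q .φ 0 : KPJet K) := (homog_base hα).mul (homog_q _ 0)
  exact add_mem (mulOp_mem_homogOps h1) (mon_mem_homogOps h2 rfl)

theorem phiOp'_mem_homogOps (hα : α′ = 0) :
    phiOp' (base α) (q .φ 0 : KPJet K) ∈ homogOps K KPVar (.A 0) 1 := by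
  have h1 : Homog 1 (q .φ 0 : KPJet K)′ := (homog_q _ 0).iter 1
  have h2 : mon 1 (base α : KPJet K) ∈ homogOps K KPVar (.A 0) 1 :=
    mon_mem_homogOps (homog_base hα) rfl
  have h3 : mulOp (q .φ 0 : KPJet K) ∈ homogOps K KPVar (.A 0) 0 :=
    mulOp_mem_homogOps (homog_q _ 0)
  exact sub_mem (comp_mem_homogOps h2 h3 rfl) (mulOp_mem_homogOps h1)

theorem mulOp_A_mem_homogOps (c n : ℕ) :
    mulOp ((c : KPJet K) * A n) ∈ homogOps K KPVar (.A 0) 0 :=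
  mulOp_mem_homogOps ((homog_A n).natCast_mul c)

theorem mon_A_mem_homogOps (k c n : ℕ) :
    mon k ((c : KPJet K) * A n) ∈ homogOps K KPVar (.A 0) k :=
  mon_mem_homogOps ((homog_A n).natCast_mul c) (add_zero k)

theorem mulOp_qInv_mem_homogOps :
    mulOp (qInv : KPJet K) ∈ homogOps K KPVar (.A 0) 0 :=
  mulOp_mem_homogOps homog_qInv

theorem benneyMatrix_mem_homogOps (hα : α′ = 0) :
    ∀ i j, benneyMatrix α i j ∈ homogOps K KPVar (.A 0) 1 := by
  have hm : ∀ m : ℕ, mulOp ((m : KPJet K) * A (m - 1) * qInv) ∈ homogOps K KPVar (.A 0) 0 :=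
    fun m => mulOp_mem_homogOps (((homog_A _).natCast_mul m).mul homog_qInv)
  have h1 : mon 1 (1 : KPJet K) ∈ homogOps K KPVar (.A 0) 1 := by
    have h : Homog 0 (1 : KPJet K) := by simpa using homog_natCast (K := K) (z := KPVar.A 0) 1
    exact mon_mem_homogOps h rfl
  intro i j
  cases i with
  | A n =>
    cases j with
    | A m =>
      exact add_mem (mon_A_mem_homogOps _ _ _)
        (comp_mem_homogOps h1 (mulOp_A_mem_homogOps _ _) rfl)
    | φ => exact comp_mem_homogOps (hm n) (phiOp'_mem_homogOps hα) rfl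
  | φ =>
    cases j with
    | A m => exact comp_mem_homogOps (phiOp_mem_homogOps hα) (hm m) rfl
    | φ => exact zero_mem _

theorem isQuasiclassicalLimit_kpMatrix (hα : α′ = 0) :
    IsQuasiclassicalLimit (kpMatrix α) (benneyMatrix α) := by
  have hB := benneyMatrix_mem_homogOps hα
  intro i j
  cases i with
  | A n =>
    cases j with
    | A m =>
      -- Here s stands for μ = s + 2: the term μ = 0 cancels and μ = 1 is the Benney entry. For n =
      -- m = 0 there is no μ = 1 term to split off, hence the separate case below.
      refine quasiclassical_of_sum (hB _ _) (n + m - 1) (fun s =>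
        mon (s + 2) ((n.choose (s + 2) : KPJet K) * A (n + m - (s + 2)))
          - negDPow (KPJet K) (s + 2) ⊙
            mulOp ((m.choose (s + 2) : KPJet K) * A (n + m - (s + 2)))) (fun s => ?_) ?_
      · exact sub_mem (mon_A_mem_homogOps _ _ _)
          (comp_mem_homogOps (negDPow_mem_homogOps _) (mulOp_A_mem_homogOps _ _) (add_zero _))
      · have h0 : ∀ a : KPJet K, mon 0 a - negDPow (KPJet K) 0 ⊙ mulOp a = 0 := fun a =>
          diffOp_ext fun f => by simp
        rcases Nat.eq_zero_or_pos (n + m) with h | h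
        · obtain ⟨rfl, rfl⟩ : n = 0 ∧ m = 0 := by omega
          refine diffOp_ext fun f => ?_
          simp [kpMatrix, benneyMatrix]
        · obtain ⟨N, hN⟩ : ∃ N, n + m = N + 1 := ⟨n + m - 1, by omega⟩
          simp only [kpMatrix, benneyMatrix]
          rw [hN, Finset.sum_range_succ', Finset.sum_range_succ']
          simp only [Nat.choose_zero_right, h0, add_zero, zero_add, Nat.choose_one_right,
            Nat.add_sub_cancel]
          rw [add_comm]
          congr 1
          refine diffOp_ext fun f => ?_
          simp [iter_succ]
    | φ =>
      -- The original term of index s + 1 has weight s + 2, one unit coming from `phiOp'`; the term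
      -- of index zero is the Benney entry.
      refine quasiclassical_of_sum (hB _ _) (n - 1) (fun s =>
        mon (s + 1) ((n.choose (s + 2) : KPJet K) * A (n - 1 - (s + 1))) ⊙
          mulOp qInv ⊙ phiOp' (base α) (q .φ 0)) (fun s => ?_) ?_
      · exact comp_mem_homogOps (mon_A_mem_homogOps _ _ _)
          (comp_mem_homogOps mulOp_qInv_mem_homogOps (phiOp'_mem_homogOps hα) (zero_add 1)) rfl
      · refine diffOp_ext fun f => ?_
        cases n with
        | zero => simp [kpMatrix, benneyMatrix]
        | succ n =>
          simp only [kpMatrix, benneyMatrix, act_add, act_comp, act_sum_op, act_mon, act_mulOp]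
          rw [Finset.sum_range_succ', add_comm]
          simp [mul_assoc]
  | φ =>
    cases j with
    | A m =>
      refine quasiclassical_of_sum (hB _ _) (m - 1) (fun s =>
        phiOp (base α) (q .φ 0) ⊙ mulOp qInv ⊙ negDPow (KPJet K) (s + 1) ⊙
          mulOp ((m.choose (s + 2) : KPJet K) * A (m - 1 - (s + 1)))) (fun s => ?_) ?_
      · exact comp_mem_homogOps (phiOp_mem_homogOps hα)
          (comp_mem_homogOps mulOp_qInv_mem_homogOps (comp_mem_homogOps (negDPow_mem_homogOps _)
            (mulOp_A_mem_homogOps _ _) (add_zero _)) (zero_add _)) (add_comm _ _)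
      · refine diffOp_ext fun f => ?_
        cases m with
        | zero => simp [kpMatrix, benneyMatrix]
        | succ m =>
          simp only [kpMatrix, benneyMatrix, act_add, act_comp, act_sum_op, act_mon, act_mulOp]
          rw [Finset.sum_range_succ', mul_add, act_map_add, Finset.mul_sum, act_map_sum, add_comm]
          congr 1
          simp [mul_left_comm, mul_comm]
    | φ =>
      exact quasiclassical_of_sum (hB _ _) 0 (fun _ => 0) (fun s => zero_mem _) (by
        simp [kpMatrix, benneyMatrix])

end Limit
end KPExt
end

theorem proposition14p15 {K : Type*} [CommRing K] [Algebra ℚ K] [Differential K]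
    (α : K) (hα : Differential.deriv α = 0) :
    KPExt.IsHamiltonian (KPExt.kpMatrix α) ∧
    KPExt.IsQuasiclassicalLimit (KPExt.kpMatrix α) (KPExt.benneyMatrix α) ∧
    KPExt.ReducesTo KPExt.kpToLW KPExt.isUnit_kpToLW
      (KPExt.kpMatrix α) (KPExt.lwMatrix α) :=
  ⟨KPExt.isHamiltonian_kpMatrix α hα, KPExt.isQuasiclassicalLimit_kpMatrix hα,
    KPExt.kp_reduces α⟩
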